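/- Let $N\ge 1$ be an integer. Let $\mathcal{U}_N\subset L^2(\mathbb{R},\mathbb{R})$ be the set of $N$-solitons $$u(x)=\sum_{j=1}^N \mathcal{R}_{c_j}(x-x_j),\qquad c_j>0,\ x_j\in\mathbb{R},\qquad \mathcal{R}(x)=\frac{2}{1+x^2},\quad \mathcal{R}_c(x)=c\,\mathcal{R}(cx).$$ Let $\mathbb{T}=\mathbb{R}/2\pi\mathbb{Z}$, and let $U_N^{\mathbb{T}}\subset L^2(\mathbb{T},\mathbb{R})$ be the set of $N$-gap potentials for the Benjamin--Ono equation on the torus, that is, of all functions $v=h+\overline{h}$ with $$h(y)=-e^{iy}\,\frac{Q'(e^{iy})}{Q(e^{iy})},$$ where $Q\in\mathbb{C}[X]$ is a monic polynomial of degree $N$ all of whose roots lie in $\{z\in\mathbb{C}:|z|>1\}$. Both sets carry the subspace topology and the real analytic structure inherited from $L^2$. Then $\mathcal{U}_N$ is a universal covering manifold of $U_N^{\mathbb{T}}$: $\mathcal{U}_N$ and $U_N^{\mathbb{T}}$ are embedded real analytic submanifolds of real dimension $2N$ of $L^2(\mathbb{R},\mathbb{R})$ and $L^2(\mathbb{T},\mathbb{R})$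 respectively, $\mathcal{U}_N$ is simply connected, and there exists a real analytic covering map $\mathcal{U}_N\to U_N^{\mathbb{T}}$ (a surjective covering map that is a local real analytic diffeomorphism). Moreover, for every base point, the fundamental group of $U_N^{\mathbb{T}}$ is isomorphic to $(\mathbb{Z},+)$. -/

import Mathlib

open MeasureTheory Set Topology

noncomputable section

namespace BenjaminOno

/-! ### Embedded real analytic submanifolds of normed spaces -/

section Submanifold

variable {E F : Type*} [NormedAddCommGroup E] [NormedSpace ℝ E]
  [NormedAddCommGroup F] [NormedSpace ℝ F]

/-- `S`, with the subspace topology, is an embedded real analytic submanifold of `E` of real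
dimension `d`: near each of its points there is a homeomorphism from a relatively open subset of
`S` onto an open subset of `ℝ^d` whose inverse, as a map into `E`, is a real analytic immersion. -/
def IsAnalyticSubmanifold (d : ℕ) (S : Set E) : Prop :=
  ∀ x : S, ∃ e : OpenPartialHomeomorph S (EuclideanSpace ℝ (Fin d)),
    x ∈ e.source ∧
    AnalyticOnNhd ℝ (fun y => (e.symm y : E)) e.target ∧
    ∀ y ∈ e.target, Function.Injective (fderiv ℝ (fun y => (e.symm y : E)) y)

/-- The map `f : S → F` is real analytic at every point of `s ⊆ S`: near such a point it is the
restriction of a map that is real analytic on a neighbourhood in the ambient space `E`.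
For an embedded analytic submanifold `S` this is analyticity in the charts of `S`. -/
def IsAnalyticMapOn {S : Set E} (f : S → F) (s : Set S) : Prop :=
  ∀ x ∈ s, ∃ g : E → F, AnalyticAt ℝ g (x : E) ∧ ∀ᶠ y : S in 𝓝 x, f y = g (y : E)

/-- `p : S → T` is a local real analytic diffeomorphism. -/
def IsAnalyticLocalDiffeo {S : Set E} {T : Set F} (p : S → T) : Prop :=
  ∀ x : S, ∃ e : OpenPartialHomeomorph S T,
    x ∈ e.source ∧ EqOn p e e.source ∧
    IsAnalyticMapOn (fun y : S => (e y : F)) e.source ∧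
    IsAnalyticMapOn (fun z : T => (e.symm z : E)) e.target

/-- `p : S → T` is a real analytic covering map: a surjective topological covering map which is
a local real analytic diffeomorphism. -/
structure IsAnalyticCoveringMap {S : Set E} {T : Set F} (p : S → T) : Prop where
  isCoveringMap : IsCoveringMap p
  surjective : Function.Surjective p
  isAnalyticLocalDiffeo : IsAnalyticLocalDiffeo p

/-- `S` is a universal covering manifold of `T`: both are embedded real analytic submanifolds (of
dimension `d`), `S` is simply connected, and there is a real analytic covering map `S → T`. -/
structure IsUniversalCoveringManifold (d : ℕ) (S : Set E) (T : Set F) : Prop where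
  submanifold_total : IsAnalyticSubmanifold d S
  submanifold_base : IsAnalyticSubmanifold d T
  simplyConnected : SimplyConnectedSpace S
  exists_covering : ∃ p : S → T, IsAnalyticCoveringMap p

end Submanifold

/-! ### Multi-solitons on the line -/

/-- The soliton profile `R(x) = 2 / (1 + x²)`. -/
def solitonProfile (x : ℝ) : ℝ := 2 / (1 + x ^ 2)

/-- The rescaled profile `R_c(x) = c R(c x)`. -/
def scaledProfile (c x : ℝ) : ℝ := c * solitonProfile (c * x)

/-- The set of `N`-solitons in `L²(ℝ, ℝ)`. -/
def solitonManifold (N : ℕ) : Set (Lp ℝ 2 (volume : Measure ℝ)) :=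
  {u | ∃ c a : Fin N → ℝ, (∀ j, 0 < c j) ∧
    ∀ᵐ x ∂(volume : Measure ℝ), u x = ∑ j, scaledProfile (c j) (x - a j)}

/-! ### Finite gap potentials on the torus -/

instance fact_two_pi_pos : Fact (0 < 2 * Real.pi) := ⟨Real.two_pi_pos⟩

/-- The function `h(y) = - e^{iy} Q'(e^{iy}) / Q(e^{iy})` on the torus `ℝ / 2πℤ`. -/
def gapFunction (Q : Polynomial ℂ) (y : AddCircle (2 * Real.pi)) : ℂ :=
  -(AddCircle.toCircle y : ℂ) * Q.derivative.eval (AddCircle.toCircle y : ℂ) /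
    Q.eval (AddCircle.toCircle y : ℂ)

/-- The set of `N`-gap potentials `h + conj h` in `L²(ℝ / 2πℤ, ℝ)`, where `Q` runs over the monic
polynomials of degree `N` with all roots in `{|z| > 1}`. -/
def gapManifold (N : ℕ) :
    Set (Lp ℝ 2 (AddCircle.haarAddCircle : Measure (AddCircle (2 * Real.pi)))) :=
  {v | ∃ Q : Polynomial ℂ, Q.Monic ∧ Q.natDegree = N ∧ (∀ z : ℂ, Q.IsRoot z → 1 < ‖z‖) ∧
    ∀ᵐ y ∂(AddCircle.haarAddCircle : Measure (AddCircle (2 * Real.pi))),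
      ((v y : ℝ) : ℂ) = gapFunction Q y + (starRingEnd ℂ) (gapFunction Q y)}

end BenjaminOno

end

/-!
Both manifolds are described by monic polynomials of degree `N` with all roots in the open unit
disc (`discPolys`, an open subset of `ℂ ^ N`). Conformally transported to the circle, an
`N`-soliton is the sum of the Poisson kernels of the roots `w j`, the images of its poles in the
upper half-plane under the Cayley transform; an `N`-gap potential is the same sum minus `N`, the
roots being the reflections `1 / conj (z j)` of the roots of `Q`, hence nonzero. The sum of Poisson
kernels is `2 Re (z P'(z) / P(z)) - N`, an analytic function of the coefficients of `P` with values
in the continuous functions on the circle. Conversely, Poisson's formula recovers the power sums of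
the roots as continuous affine functions of the potential in `L²`, and Newton's identities turn
these into the coefficients. So the coefficients are global analytic coordinates on both manifolds
(`isAnalyticParametrization_solitonManifold`, `isAnalyticParametrization_gapManifold`), with an
inverse that is analytic on the ambient `L²` space; this gives the embedded submanifold structures.

It remains to cover the polynomials with nonzero constant coefficient by all of `discPolys`. In
Szegő's recursion the constant coefficient is, up to conjugation and sign, the last Schur
parameter, and ranges over the unit disc independently of the other ones. Changing only this
parameter (`setConst`) by the holomorphic universal covering `a ↦ exp ((a + 1) / (a - 1))` of the
punctured disc by the disc is the required covering `coverMap`; its group of deck transformations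
is `ℤ` (`isAddQuotientCoveringMap_coverMap`). Since `discPolys` is contractible, by scaling the
roots, this is a universal covering, and the fundamental group of the base is `ℤ`.
-/

namespace BenjaminOno

open Polynomial ComplexConjugate

variable {N : ℕ}

/-! ### Monic polynomials and their coefficients -/

/-- The monic polynomial of degree `N` whose lower coefficients are the entries of `c`. -/
noncomputable def monicPoly {N : ℕ} (c : Fin N → ℂ) : ℂ[X] :=
  X ^ N + ∑ k : Fin N, C (c k) * X ^ (k : ℕ)

/-- The lower coefficients of the monic polynomial with roots `w 0, …, w (N - 1)`. -/
noncomputable def rootCoeff {N : ℕ} (w : Fin N → ℂ) : Fin N → ℂ :=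
  fun k => (∏ j, (X - C (w j))).coeff k

lemma coeff_monicPoly (c : Fin N → ℂ) (k : ℕ) :
    (monicPoly c).coeff k = if h : k < N then c ⟨k, h⟩ else if k = N then 1 else 0 := by
  simp only [monicPoly, coeff_add, coeff_X_pow, finsetSum_coeff, coeff_C_mul]
  by_cases h : k < N
  · rw [dif_pos h, if_neg h.ne, zero_add, Finset.sum_eq_single ⟨k, h⟩]
    · simp
    · intro j _ hj
      rw [if_neg, mul_zero]
      exact fun h' => hj (Fin.ext h'.symm)
    · simp
  · rw [dif_neg h, Finset.sum_eq_zero, add_zero]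
    intro j _
    rw [if_neg, mul_zero]
    have := j.2
    omega

lemma coeff_monicPoly_fin (c : Fin N → ℂ) (k : Fin N) : (monicPoly c).coeff k = c k := by
  simp [coeff_monicPoly]

lemma coeff_monicPoly_self (c : Fin N → ℂ) : (monicPoly c).coeff N = 1 := by
  simp [coeff_monicPoly]

lemma natDegree_monicPoly (c : Fin N → ℂ) : (monicPoly c).natDegree = N := by
  refine natDegree_eq_of_le_of_coeff_ne_zero ?_ (by simp [coeff_monicPoly_self])
  refine natDegree_le_iff_coeff_eq_zero.2 fun k hk => ?_
  rw [coeff_monicPoly, dif_neg (by omega), if_neg (by omega)]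

lemma monic_monicPoly (c : Fin N → ℂ) : (monicPoly c).Monic := by
  rw [Monic, leadingCoeff, natDegree_monicPoly, coeff_monicPoly_self]

lemma eval_monicPoly (c : Fin N → ℂ) (z : ℂ) :
    (monicPoly c).eval z = z ^ N + ∑ k : Fin N, c k * z ^ (k : ℕ) := by
  simp [monicPoly, eval_finsetSum]

lemma monicPoly_coeff {P : ℂ[X]} (hP : P.Monic) (hN : P.natDegree = N) :
    monicPoly (fun k : Fin N => P.coeff k) = P := by
  ext k
  rw [coeff_monicPoly]
  split_ifs with h h'
  · rfl
  · rw [h', ← hN]; exact hP.symm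
  · exact (coeff_eq_zero_of_natDegree_lt (by omega)).symm

lemma monicPoly_rootCoeff (w : Fin N → ℂ) :
    monicPoly (rootCoeff w) = ∏ j, (X - C (w j)) :=
  monicPoly_coeff (monic_prod_X_sub_C _ _) (by simp)

lemma eval_monicPoly_rootCoeff (w : Fin N → ℂ) (z : ℂ) :
    (monicPoly (rootCoeff w)).eval z = ∏ j, (z - w j) := by
  simp [monicPoly_rootCoeff, eval_prod]

lemma exists_fin_map_of_card {α : Type*} (s : Multiset α) (h : s.card = N) :
    ∃ w : Fin N → α, s = Multiset.map w Finset.univ.val := by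
  subst h
  refine ⟨fun i => s.toList.get (i.cast (by simp)), ?_⟩
  have h1 : Multiset.map (fun i : Fin s.card => s.toList.get (i.cast (by simp))) Finset.univ.val
      = (List.ofFn fun i : Fin s.card => s.toList.get (i.cast (by simp)) : Multiset α) := by
    simp
  rw [h1]
  conv_lhs => rw [← s.coe_toList]
  congr 1
  apply List.ext_get <;> simp

lemma exists_prod_X_sub_C {P : ℂ[X]} (hP : P.Monic) (hN : P.natDegree = N) :
    ∃ w : Fin N → ℂ, P = ∏ j, (X - C (w j)) := by
  have hs := IsAlgClosed.splits P
  obtain ⟨w, hw⟩ := exists_fin_map_of_card P.roots (hs.natDegree_eq_card_roots.symm.trans hN)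
  refine ⟨w, ?_⟩
  conv_lhs => rw [hs.eq_prod_roots_of_monic hP, hw]
  rw [Multiset.map_map]
  rfl

lemma exists_eq_rootCoeff (c : Fin N → ℂ) : ∃ w : Fin N → ℂ, c = rootCoeff w := by
  obtain ⟨w, hw⟩ := exists_prod_X_sub_C (monic_monicPoly c) (natDegree_monicPoly c)
  refine ⟨w, funext fun k => ?_⟩
  rw [rootCoeff, ← hw, coeff_monicPoly_fin]

/-! ### Monic polynomials with all roots in the unit disc -/

/-- The lower coefficients of the monic polynomials of degree `N` with all roots in the open unit
disc. -/
def discPolys (N : ℕ) : Set (Fin N → ℂ) := {c | ∀ z, (monicPoly c).IsRoot z → ‖z‖ < 1}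

/-- The coefficients in `discPolys N` whose polynomial does not vanish at the origin. -/
def puncturedDiscPolys (N : ℕ) : Set (Fin N → ℂ) :=
  {c | c ∈ discPolys N ∧ (monicPoly c).coeff 0 ≠ 0}

lemma rootCoeff_mem_discPolys_iff {w : Fin N → ℂ} :
    rootCoeff w ∈ discPolys N ↔ ∀ j, ‖w j‖ < 1 := by
  simp only [discPolys, mem_ofPred_eq, IsRoot, eval_monicPoly_rootCoeff, Finset.prod_eq_zero_iff,
    Finset.mem_univ, true_and, sub_eq_zero]
  exact ⟨fun h j => h _ ⟨j, rfl⟩, by rintro h z ⟨j, rfl⟩; exact h j⟩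

lemma exists_roots_of_mem_discPolys {c : Fin N → ℂ} (hc : c ∈ discPolys N) :
    ∃ w : Fin N → ℂ, (∀ j, ‖w j‖ < 1) ∧ c = rootCoeff w := by
  obtain ⟨w, rfl⟩ := exists_eq_rootCoeff c
  exact ⟨w, rootCoeff_mem_discPolys_iff.1 hc, rfl⟩

lemma coeff_zero_rootCoeff (w : Fin N → ℂ) :
    (monicPoly (rootCoeff w)).coeff 0 = ∏ j, (-w j) := by
  simp [coeff_zero_eq_eval_zero, eval_monicPoly_rootCoeff]

lemma rootCoeff_mem_puncturedDiscPolys_iff {w : Fin N → ℂ} :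
    rootCoeff w ∈ puncturedDiscPolys N ↔ (∀ j, ‖w j‖ < 1) ∧ ∀ j, w j ≠ 0 := by
  simp [puncturedDiscPolys, rootCoeff_mem_discPolys_iff, coeff_zero_rootCoeff,
    Finset.prod_eq_zero_iff]

lemma norm_coeff_zero_lt_one (hN : 0 < N) {c : Fin N → ℂ} (hc : c ∈ discPolys N) :
    ‖(monicPoly c).coeff 0‖ < 1 := by
  obtain ⟨w, hw, rfl⟩ := exists_roots_of_mem_discPolys hc
  rw [coeff_zero_rootCoeff, norm_prod]
  have : Nonempty (Fin N) := ⟨⟨0, hN⟩⟩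
  by_cases h0 : ∃ j, w j = 0
  · obtain ⟨j, hj⟩ := h0
    rw [Finset.prod_eq_zero (Finset.mem_univ j) (by simp [hj])]
    exact one_pos
  · push Not at h0
    calc ∏ j, ‖-w j‖ < ∏ _j : Fin N, (1 : ℝ) :=
          Finset.prod_lt_prod_of_nonempty (fun j _ => by simpa using h0 j)
            (fun j _ => by simpa using hw j) Finset.univ_nonempty
      _ = 1 := by simp

lemma analyticAt_coeff_monicPoly (k : ℕ) (c : Fin N → ℂ) :
    AnalyticAt ℝ (fun c : Fin N → ℂ => (monicPoly c).coeff k) c := by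
  simp only [coeff_monicPoly]
  by_cases h : k < N
  · simp only [dif_pos h]
    exact (ContinuousLinearMap.proj (R := ℝ) (φ := fun _ : Fin N => ℂ) ⟨k, h⟩).analyticAt c
  · simp only [dif_neg h]
    exact analyticAt_const

lemma continuous_coeff_monicPoly (k : ℕ) :
    Continuous (fun c : Fin N → ℂ => (monicPoly c).coeff k) :=
  continuous_iff_continuousAt.2 fun c => (analyticAt_coeff_monicPoly k c).continuousAt

/-- Writing a root outside the open disc as `z = 1 / y`, the complement of `discPolys N` is the
projection of a closed set along the compact disc `‖y‖ ≤ 1`. -/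
lemma isOpen_discPolys (N : ℕ) : IsOpen (discPolys N) := by
  let K := Metric.closedBall (0 : ℂ) 1
  have : CompactSpace K := isCompact_iff_compactSpace.1 (isCompact_closedBall 0 1)
  let Z : Set ((Fin N → ℂ) × K) :=
    {p | 1 + ∑ k : Fin N, p.1 k * (p.2 : ℂ) ^ (N - (k : ℕ)) = 0}
  have hZ : IsClosed Z := isClosed_eq (by fun_prop) continuous_const
  have h := isClosedMap_fst_of_compactSpace Z hZ
  suffices hs : (discPolys N)ᶜ = Prod.fst '' Z from
    isClosed_compl_iff.1 (hs ▸ h)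
  have key (c : Fin N → ℂ) (y : ℂ) (hy : y ≠ 0) :
      1 + ∑ k : Fin N, c k * y ^ (N - (k : ℕ)) = y ^ N * (monicPoly c).eval y⁻¹ := by
    rw [eval_monicPoly, mul_add, ← mul_pow, mul_inv_cancel₀ hy, one_pow, Finset.mul_sum]
    congr 1
    refine Finset.sum_congr rfl fun k _ => ?_
    rw [pow_sub₀ _ hy k.2.le, inv_pow]
    ring
  ext c
  simp only [discPolys, mem_compl_iff, mem_ofPred_eq, not_forall, not_lt, mem_image, Prod.exists,
    exists_and_right, exists_eq_right, Z, K, Subtype.exists, Metric.mem_closedBall,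
    dist_zero_right]
  constructor
  · rintro ⟨z, hz, h1⟩
    have hz0 : z ≠ 0 := by rintro rfl; simp at h1; linarith
    refine ⟨z⁻¹, by simpa using inv_le_one_of_one_le₀ h1, ?_⟩
    rw [key c _ (inv_ne_zero hz0), inv_inv, hz.eq_zero, mul_zero]
  · rintro ⟨y, hy, h0⟩
    have hy0 : y ≠ 0 := by
      rintro rfl
      rw [Finset.sum_eq_zero, add_zero] at h0
      · exact one_ne_zero h0
      · intro k _
        have := k.2
        rw [zero_pow (by omega), mul_zero]
    refine ⟨y⁻¹, ?_, by simpa using one_le_inv_iff₀.2 ⟨norm_pos_iff.2 hy0, hy⟩⟩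
    rw [key c y hy0] at h0
    exact (mul_eq_zero.1 h0).resolve_left (pow_ne_zero _ hy0)

lemma isOpen_puncturedDiscPolys (N : ℕ) : IsOpen (puncturedDiscPolys N) :=
  (isOpen_discPolys N).inter (isOpen_ne_fun (continuous_coeff_monicPoly 0) continuous_const)

/-- Multiplying all roots by `t` multiplies the coefficient of `X ^ k` by `t ^ (N - k)`; letting `t`
run from `1` to `0` contracts the space. -/
lemma contractibleSpace_discPolys (N : ℕ) : ContractibleSpace (discPolys N) := by
  have hmem (t : unitInterval) (c : discPolys N) :
      (fun k : Fin N => ((t : ℝ) : ℂ) ^ (N - (k : ℕ)) * (c : Fin N → ℂ) k) ∈ discPolys N := by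
    intro z hz
    rw [IsRoot, eval_monicPoly] at hz
    rcases eq_or_ne (t : ℝ) 0 with ht | ht
    · rw [Finset.sum_eq_zero, add_zero] at hz
      · rw [eq_zero_of_pow_eq_zero hz]; simp
      · intro k _
        have := k.2
        rw [ht, Complex.ofReal_zero, zero_pow (by omega), zero_mul, zero_mul]
    · have ht' : ((t : ℝ) : ℂ) ≠ 0 := by exact_mod_cast ht
      have hroot : (monicPoly (c : Fin N → ℂ)).IsRoot (z / (t : ℝ)) := by
        rw [IsRoot, eval_monicPoly]
        have : ((t : ℝ) : ℂ) ^ N * ((z / (t : ℝ)) ^ N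
            + ∑ k : Fin N, (c : Fin N → ℂ) k * (z / (t : ℝ)) ^ (k : ℕ)) = 0 := by
          rw [← hz, mul_add, ← mul_pow, mul_div_cancel₀ _ ht', Finset.mul_sum]
          congr 1
          refine Finset.sum_congr rfl fun k _ => ?_
          rw [pow_sub₀ _ ht' k.2.le, div_pow]
          field_simp
        exact (mul_eq_zero.1 this).resolve_left (pow_ne_zero _ ht')
      have h1 := c.2 _ hroot
      have ht0 : 0 < (t : ℝ) := lt_of_le_of_ne t.2.1 ht.symm
      rw [norm_div, Complex.norm_real, Real.norm_of_nonneg t.2.1, div_lt_one ht0] at h1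
      exact h1.trans_le t.2.2
  have h0 : (0 : Fin N → ℂ) ∈ discPolys N := by
    intro z hz
    rcases N.eq_zero_or_pos with rfl | hN
    · simp [IsRoot, eval_monicPoly] at hz
    · simp only [IsRoot, eval_monicPoly, Pi.zero_apply, zero_mul, Finset.sum_const_zero,
        add_zero] at hz
      rw [eq_zero_of_pow_eq_zero hz]; simp
  refine (contractible_iff_id_nullhomotopic _).2 ⟨⟨0, h0⟩, ⟨ContinuousMap.Homotopy.symm
    { toFun := fun p => ⟨_, hmem p.1 p.2⟩
      continuous_toFun := Continuous.subtype_mk (continuous_pi fun k =>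
        ((Complex.continuous_ofReal.comp (continuous_subtype_val.comp continuous_fst)).pow _).mul
          ((continuous_apply k).comp (continuous_subtype_val.comp continuous_snd))) _
      map_zero_left := fun c => ?_
      map_one_left := fun c => ?_ }⟩⟩
  · ext k
    have := k.2
    simp [show N - (k : ℕ) ≠ 0 by omega]
  · ext k; simp

/-! ### Changing the last Schur parameter -/

/-- The coefficients of `((1 - \bar a b) P + (b - a) P^*) / (1 - |a|²)`, where `P` is the polynomial
with coefficients `c`, `a = P(0)` and `P^*(z) = z ^ N \overline{P(1 / \bar z)}`. By Szegő's
recursion this is the monic polynomial whose constant coefficient is `b` and whose other Schur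
parameters are those of `P`. -/
noncomputable def setConst (b : ℂ) (c : Fin N → ℂ) : Fin N → ℂ := fun k =>
  ((1 - conj ((monicPoly c).coeff 0) * b) * c k
      + (b - (monicPoly c).coeff 0) * conj ((monicPoly c).coeff (N - k))) /
    (1 - (monicPoly c).coeff 0 * conj ((monicPoly c).coeff 0))

lemma one_sub_conj_mul_ne_zero {a b : ℂ} (ha : ‖a‖ < 1) (hb : ‖b‖ < 1) : 1 - conj a * b ≠ 0 := by
  intro h
  have : ‖conj a * b‖ = 1 := by rw [← sub_eq_zero.1 h]; simp
  rw [norm_mul, RCLike.norm_conj] at this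
  nlinarith [norm_nonneg a, norm_nonneg b]

lemma one_sub_mul_conj_ne_zero {a : ℂ} (ha : ‖a‖ < 1) : 1 - a * conj a ≠ 0 := by
  rw [mul_comm]; exact one_sub_conj_mul_ne_zero ha ha

lemma coeff_setConst {c : Fin N → ℂ} (ha : ‖(monicPoly c).coeff 0‖ < 1) (b : ℂ) {k : ℕ}
    (hk : k ≤ N) :
    (monicPoly (setConst b c)).coeff k =
      ((1 - conj ((monicPoly c).coeff 0) * b) * (monicPoly c).coeff k
        + (b - (monicPoly c).coeff 0) * conj ((monicPoly c).coeff (N - k))) /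
      (1 - (monicPoly c).coeff 0 * conj ((monicPoly c).coeff 0)) := by
  rcases hk.lt_or_eq with h | rfl
  · rw [show k = ((⟨k, h⟩ : Fin N) : ℕ) from rfl, coeff_monicPoly_fin, coeff_monicPoly_fin]
    rfl
  · rw [coeff_monicPoly_self, coeff_monicPoly_self, Nat.sub_self,
      eq_div_iff (one_sub_mul_conj_ne_zero ha)]
    ring

lemma coeff_zero_setConst {c : Fin N → ℂ} (ha : ‖(monicPoly c).coeff 0‖ < 1) (b : ℂ) :
    (monicPoly (setConst b c)).coeff 0 = b := by
  rw [coeff_setConst ha b N.zero_le, Nat.sub_zero, coeff_monicPoly_self, map_one,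
    div_eq_iff (one_sub_mul_conj_ne_zero ha)]
  ring

lemma setConst_coeff_zero {c : Fin N → ℂ} (ha : ‖(monicPoly c).coeff 0‖ < 1) :
    setConst ((monicPoly c).coeff 0) c = c := by
  ext k
  have := one_sub_mul_conj_ne_zero ha
  rw [setConst, div_eq_iff this]
  ring

lemma setConst_setConst {c : Fin N → ℂ} (ha : ‖(monicPoly c).coeff 0‖ < 1) {b : ℂ}
    (hb : ‖b‖ < 1) (b' : ℂ) : setConst b' (setConst b c) = setConst b' c := by
  ext k
  have h1 := one_sub_mul_conj_ne_zero ha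
  have h2 := one_sub_mul_conj_ne_zero hb
  have h3 : 1 - conj ((monicPoly c).coeff 0) * (monicPoly c).coeff 0 ≠ 0 := by
    rwa [mul_comm]
  rw [setConst, coeff_zero_setConst ha, coeff_setConst ha b (Nat.sub_le _ _),
    Nat.sub_sub_self k.2.le, coeff_monicPoly_fin, setConst, setConst, div_eq_iff h2]
  simp only [map_div₀, map_add, map_sub, map_mul, map_one, Complex.conj_conj]
  rw [mul_comm (conj _) ((monicPoly c).coeff 0)]
  field_simp
  ring

lemma eval_setConst {c : Fin N → ℂ} (ha : ‖(monicPoly c).coeff 0‖ < 1) (b : ℂ) {z : ℂ}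
    (hz : z ≠ 0) :
    (monicPoly (setConst b c)).eval z =
      ((1 - conj ((monicPoly c).coeff 0) * b) * (monicPoly c).eval z
        + (b - (monicPoly c).coeff 0) * (z ^ N * conj ((monicPoly c).eval (conj z)⁻¹))) /
      (1 - (monicPoly c).coeff 0 * conj ((monicPoly c).coeff 0)) := by
  have hstar : z ^ N * conj ((monicPoly c).eval (conj z)⁻¹) =
      ∑ k ∈ Finset.range (N + 1), conj ((monicPoly c).coeff (N - k)) * z ^ k := by
    rw [eval_eq_sum_range, natDegree_monicPoly, map_sum, Finset.mul_sum,
      ← Finset.sum_range_reflect]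
    refine Finset.sum_congr rfl fun k hk => ?_
    have hk' : k ≤ N := by simpa [Nat.lt_succ_iff] using hk
    simp only [map_mul, map_pow, map_inv₀, Complex.conj_conj]
    rw [show N + 1 - 1 - k = N - k by omega, inv_pow, pow_sub₀ _ hz hk']
    field_simp
  rw [hstar, eval_eq_sum_range, eval_eq_sum_range, natDegree_monicPoly, natDegree_monicPoly,
    Finset.mul_sum, Finset.mul_sum, ← Finset.sum_add_distrib, Finset.sum_div]
  refine Finset.sum_congr rfl fun k hk => ?_
  rw [coeff_setConst ha b (by simpa [Nat.lt_succ_iff] using hk)]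
  ring

lemma norm_sub_lt_norm_one_sub_conj_mul {a b : ℂ} (ha : ‖a‖ < 1) (hb : ‖b‖ < 1) :
    ‖b - a‖ < ‖1 - conj a * b‖ := by
  rw [← sq_lt_sq₀ (norm_nonneg _) (norm_nonneg _)]
  have ha' : ‖a‖ ^ 2 < 1 := by nlinarith [norm_nonneg a]
  have hb' : ‖b‖ ^ 2 < 1 := by nlinarith [norm_nonneg b]
  rw [Complex.sq_norm, Complex.normSq_apply] at *
  rw [Complex.sq_norm, Complex.normSq_apply] at *
  simp only [Complex.sub_re, Complex.sub_im, Complex.mul_re, Complex.mul_im, Complex.conj_re,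
    Complex.conj_im, Complex.one_re, Complex.one_im]
  nlinarith [mul_pos (sub_pos.2 ha') (sub_pos.2 hb')]

lemma norm_mul_inv_conj_sub_le {z w : ℂ} (hz : 1 ≤ ‖z‖) (hw : ‖w‖ < 1) :
    ‖z‖ * ‖(conj z)⁻¹ - w‖ ≤ ‖z - w‖ := by
  have hz0 : conj z ≠ 0 := by
    rw [Ne, map_eq_zero]; rintro rfl; simp at hz; linarith
  have h1 : ‖z‖ * ‖(conj z)⁻¹ - w‖ = ‖1 - conj z * w‖ := by
    rw [← RCLike.norm_conj z, ← norm_mul, mul_sub, mul_inv_cancel₀ hz0]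
  rw [h1, ← sq_le_sq₀ (norm_nonneg _) (norm_nonneg _)]
  have hz' : 1 ≤ ‖z‖ ^ 2 := by nlinarith
  have hw' : ‖w‖ ^ 2 < 1 := by nlinarith [norm_nonneg w]
  rw [Complex.sq_norm, Complex.normSq_apply] at *
  rw [Complex.sq_norm, Complex.normSq_apply] at *
  simp only [Complex.sub_re, Complex.sub_im, Complex.mul_re, Complex.mul_im, Complex.conj_re,
    Complex.conj_im, Complex.one_re, Complex.one_im]
  nlinarith [mul_nonneg (sub_nonneg.2 hz') (sub_pos.2 hw').le]

/-- Outside the disc `|P^*| ≤ |P|` and `|b - a| < |1 - \bar a b|`, so no root can appear there. -/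
lemma setConst_mem_discPolys (hN : 0 < N) {c : Fin N → ℂ} (hc : c ∈ discPolys N) {b : ℂ}
    (hb : ‖b‖ < 1) : setConst b c ∈ discPolys N := by
  intro z hroot
  by_contra! hz
  have ha := norm_coeff_zero_lt_one hN hc
  have hz0 : z ≠ 0 := by rintro rfl; simp at hz; linarith
  have hP : 0 < ‖(monicPoly c).eval z‖ := by
    rw [norm_pos_iff]
    intro h
    exact absurd (hc z h) (not_lt.2 hz)
  have hle : ‖z ^ N * conj ((monicPoly c).eval (conj z)⁻¹)‖ ≤ ‖(monicPoly c).eval z‖ := by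
    obtain ⟨w, hw, rfl⟩ := exists_roots_of_mem_discPolys hc
    rw [eval_monicPoly_rootCoeff, eval_monicPoly_rootCoeff, norm_mul, RCLike.norm_conj, norm_prod,
      norm_prod, norm_pow, show ‖z‖ ^ N = ∏ _j : Fin N, ‖z‖ by simp, ← Finset.prod_mul_distrib]
    exact Finset.prod_le_prod (fun _ _ => by positivity)
      fun j _ => norm_mul_inv_conj_sub_le hz (hw j)
  rw [IsRoot, eval_setConst ha b hz0, div_eq_zero_iff,
    or_iff_left (one_sub_mul_conj_ne_zero ha)] at hroot
  have h1 := congrArg norm (eq_neg_of_add_eq_zero_left hroot)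
  rw [norm_neg, norm_mul, norm_mul] at h1
  have h2 := norm_sub_lt_norm_one_sub_conj_mul ha hb
  nlinarith [norm_nonneg (b - (monicPoly c).coeff 0)]

lemma analyticAt_conj (z : ℂ) : AnalyticAt ℝ (fun z : ℂ => conj z) z :=
  Complex.conjCLE.analyticAt z

lemma analyticAt_setConst {b : ℂ} {c : Fin N → ℂ} (ha : ‖(monicPoly c).coeff 0‖ < 1) :
    AnalyticAt ℝ (fun p : ℂ × (Fin N → ℂ) => setConst p.1 p.2) (b, c) := by
  have hc (k : ℕ) : AnalyticAt ℝ (fun p : ℂ × (Fin N → ℂ) => (monicPoly p.2).coeff k) (b, c) :=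
    AnalyticAt.fun_comp (f := fun p : ℂ × (Fin N → ℂ) => p.2) (x := (b, c))
      (analyticAt_coeff_monicPoly k c) analyticAt_snd
  have hcc (k : ℕ) :
      AnalyticAt ℝ (fun p : ℂ × (Fin N → ℂ) => conj ((monicPoly p.2).coeff k)) (b, c) :=
    (analyticAt_conj _).fun_comp (hc k)
  refine AnalyticAt.pi fun k => ?_
  have hk : AnalyticAt ℝ (fun p : ℂ × (Fin N → ℂ) => p.2 k) (b, c) := by
    simpa only [coeff_monicPoly_fin] using hc k
  exact AnalyticAt.div (((analyticAt_const.sub ((hcc 0).mul analyticAt_fst)).mul hk).add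
    ((analyticAt_fst.sub (hc 0)).mul (hcc _))) (analyticAt_const.sub ((hc 0).mul (hcc 0)))
    (one_sub_mul_conj_ne_zero ha)

/-! ### The covering of the punctured disc by the disc -/

/-- The Möbius involution `a ↦ (a + 1) / (a - 1)`, which exchanges the open unit disc and the left
half-plane. -/
noncomputable def discInvolution (a : ℂ) : ℂ := (a + 1) / (a - 1)

lemma ne_one_of_norm_lt_one {a : ℂ} (ha : ‖a‖ < 1) : a ≠ 1 := by
  rintro rfl; simp at ha

lemma ne_one_of_re_neg {a : ℂ} (ha : a.re < 0) : a ≠ 1 := by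
  rintro rfl; norm_num at ha

lemma discInvolution_discInvolution {a : ℂ} (ha : a ≠ 1) :
    discInvolution (discInvolution a) = a := by
  have h : a - 1 ≠ 0 := sub_ne_zero.2 ha
  have h1 : (a + 1) / (a - 1) + 1 = 2 * a / (a - 1) := by field_simp; ring
  have h2 : (a + 1) / (a - 1) - 1 = 2 / (a - 1) := by field_simp; ring
  rw [discInvolution, discInvolution, h1, h2]
  field_simp

lemma discInvolution_re_neg {a : ℂ} (ha : ‖a‖ < 1) : (discInvolution a).re < 0 := by
  have h1 : 0 < Complex.normSq (a - 1) :=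
    Complex.normSq_pos.2 (sub_ne_zero.2 (ne_one_of_norm_lt_one ha))
  have h2 : ‖a‖ ^ 2 < 1 := by nlinarith [norm_nonneg a]
  rw [Complex.sq_norm, Complex.normSq_apply] at h2
  rw [discInvolution, Complex.div_re, ← add_div]
  refine div_neg_of_neg_of_pos ?_ h1
  simp only [Complex.add_re, Complex.sub_re, Complex.add_im, Complex.sub_im, Complex.one_re,
    Complex.one_im]
  nlinarith

lemma norm_discInvolution_lt_one {a : ℂ} (ha : a.re < 0) : ‖discInvolution a‖ < 1 := by
  have h0 : 0 < ‖a - 1‖ := norm_pos_iff.2 (sub_ne_zero.2 (ne_one_of_re_neg ha))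
  rw [discInvolution, norm_div, div_lt_one h0, ← sq_lt_sq₀ (norm_nonneg _) (norm_nonneg _),
    Complex.sq_norm, Complex.sq_norm, Complex.normSq_apply, Complex.normSq_apply]
  simp only [Complex.add_re, Complex.sub_re, Complex.add_im, Complex.sub_im, Complex.one_re,
    Complex.one_im]
  nlinarith

lemma analyticAt_discInvolution {a : ℂ} (ha : a ≠ 1) : AnalyticAt ℝ discInvolution a :=
  (analyticAt_id.add analyticAt_const).div (analyticAt_id.sub analyticAt_const)
    (sub_ne_zero.2 ha)

/-- The holomorphic universal covering `a ↦ exp ((a + 1) / (a - 1))` of the punctured unit disc by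
the unit disc. -/
noncomputable def puncturedDiscCover (a : ℂ) : ℂ := Complex.exp (discInvolution a)

lemma norm_puncturedDiscCover_lt_one {a : ℂ} (ha : ‖a‖ < 1) : ‖puncturedDiscCover a‖ < 1 := by
  rw [puncturedDiscCover, Complex.norm_exp, Real.exp_lt_one_iff]
  exact discInvolution_re_neg ha

lemma puncturedDiscCover_ne_zero (a : ℂ) : puncturedDiscCover a ≠ 0 := Complex.exp_ne_zero _

lemma analyticAt_puncturedDiscCover {a : ℂ} (ha : a ≠ 1) :
    AnalyticAt ℝ puncturedDiscCover a :=
  AnalyticAt.comp (analyticAt_cexp.restrictScalars) (analyticAt_discInvolution ha)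

/-- The section of `puncturedDiscCover` that sends `puncturedDiscCover a` to `a` and is given by
the principal branch of the logarithm around that point. -/
noncomputable def puncturedDiscSection (a b : ℂ) : ℂ :=
  discInvolution (discInvolution a + Complex.log (b / puncturedDiscCover a))

/-- The real part is `log ‖b‖`: the section is defined on the whole punctured disc. -/
lemma puncturedDiscSection_arg_re_neg (a : ℂ) {b : ℂ} (hb : ‖b‖ < 1) (hb0 : b ≠ 0) :
    (discInvolution a + Complex.log (b / puncturedDiscCover a)).re < 0 := by
  rw [Complex.add_re, Complex.log_re, norm_div, Real.log_div (norm_ne_zero_iff.2 hb0)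
    (norm_ne_zero_iff.2 (puncturedDiscCover_ne_zero a)), puncturedDiscCover, Complex.norm_exp,
    Real.log_exp, add_sub_cancel]
  exact Real.log_neg (norm_pos_iff.2 hb0) hb

lemma norm_puncturedDiscSection_lt_one (a : ℂ) {b : ℂ} (hb : ‖b‖ < 1) (hb0 : b ≠ 0) :
    ‖puncturedDiscSection a b‖ < 1 :=
  norm_discInvolution_lt_one (puncturedDiscSection_arg_re_neg a hb hb0)

lemma puncturedDiscCover_section (a : ℂ) {b : ℂ} (hb : ‖b‖ < 1) (hb0 : b ≠ 0) :
    puncturedDiscCover (puncturedDiscSection a b) = b := by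
  rw [puncturedDiscCover, puncturedDiscSection, discInvolution_discInvolution
    (ne_one_of_re_neg (puncturedDiscSection_arg_re_neg a hb hb0)), Complex.exp_add,
    Complex.exp_log (div_ne_zero hb0 (puncturedDiscCover_ne_zero a)), ← puncturedDiscCover,
    mul_div_cancel₀ _ (puncturedDiscCover_ne_zero a)]

lemma puncturedDiscSection_cover {a : ℂ} (ha : ‖a‖ < 1) :
    puncturedDiscSection a (puncturedDiscCover a) = a := by
  rw [puncturedDiscSection, div_self (puncturedDiscCover_ne_zero a), Complex.log_one, add_zero,
    discInvolution_discInvolution (ne_one_of_norm_lt_one ha)]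

lemma analyticAt_puncturedDiscSection {a : ℂ} (ha : ‖a‖ < 1) :
    AnalyticAt ℝ (puncturedDiscSection a) (puncturedDiscCover a) := by
  have h0 : discInvolution a + Complex.log (puncturedDiscCover a / puncturedDiscCover a)
      = discInvolution a := by
    rw [div_self (puncturedDiscCover_ne_zero a), Complex.log_one, add_zero]
  have hlog : AnalyticAt ℝ (fun b => Complex.log (b / puncturedDiscCover a))
      (puncturedDiscCover a) := by
    refine AnalyticAt.fun_comp (g := Complex.log) (f := fun b => b / puncturedDiscCover a) ?_
      (analyticAt_id.div analyticAt_const (puncturedDiscCover_ne_zero a))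
    rw [div_self (puncturedDiscCover_ne_zero a)]
    exact (analyticAt_clog (by simp)).restrictScalars
  refine AnalyticAt.fun_comp (g := discInvolution) ?_ (analyticAt_const.add hlog)
  rw [h0]
  exact analyticAt_discInvolution (ne_one_of_re_neg (discInvolution_re_neg ha))

/-- The deck transformations of `puncturedDiscCover`. -/
noncomputable def deckDisc (n : ℤ) (a : ℂ) : ℂ :=
  discInvolution (discInvolution a + n * (2 * Real.pi * Complex.I))

lemma deckDisc_arg_re_neg (n : ℤ) {a : ℂ} (ha : ‖a‖ < 1) :
    (discInvolution a + n * (2 * Real.pi * Complex.I)).re < 0 := by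
  simpa using discInvolution_re_neg ha

lemma norm_deckDisc_lt_one (n : ℤ) {a : ℂ} (ha : ‖a‖ < 1) : ‖deckDisc n a‖ < 1 :=
  norm_discInvolution_lt_one (deckDisc_arg_re_neg n ha)

lemma discInvolution_deckDisc (n : ℤ) {a : ℂ} (ha : ‖a‖ < 1) :
    discInvolution (deckDisc n a) = discInvolution a + n * (2 * Real.pi * Complex.I) :=
  discInvolution_discInvolution (ne_one_of_re_neg (deckDisc_arg_re_neg n ha))

lemma deckDisc_zero {a : ℂ} (ha : ‖a‖ < 1) : deckDisc 0 a = a := by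
  simp [deckDisc, discInvolution_discInvolution (ne_one_of_norm_lt_one ha)]

lemma deckDisc_add (m n : ℤ) {a : ℂ} (ha : ‖a‖ < 1) :
    deckDisc (m + n) a = deckDisc m (deckDisc n a) := by
  rw [deckDisc, deckDisc, discInvolution_deckDisc n ha]
  push_cast
  ring_nf

lemma puncturedDiscCover_eq_iff {a a' : ℂ} (ha : ‖a‖ < 1) (ha' : ‖a'‖ < 1) :
    puncturedDiscCover a = puncturedDiscCover a' ↔ ∃ n : ℤ, deckDisc n a' = a := by
  rw [puncturedDiscCover, puncturedDiscCover, Complex.exp_eq_exp_iff_exists_int]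
  refine exists_congr fun n => ⟨fun h => ?_, fun h => ?_⟩
  · rw [deckDisc, ← h, discInvolution_discInvolution (ne_one_of_norm_lt_one ha)]
  · rw [← h, discInvolution_deckDisc n ha']

lemma analyticAt_deckDisc (n : ℤ) {a : ℂ} (ha : ‖a‖ < 1) : AnalyticAt ℝ (deckDisc n) a :=
  AnalyticAt.fun_comp (g := discInvolution)
    (analyticAt_discInvolution (ne_one_of_re_neg (deckDisc_arg_re_neg n ha)))
    ((analyticAt_discInvolution (ne_one_of_norm_lt_one ha)).add analyticAt_const)

/-! ### The universal covering at the level of coefficients -/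

section Covering

variable (hN : 0 < N)

/-- The map on coefficients that applies `puncturedDiscCover` to the constant coefficient and keeps
the other Schur parameters. -/
noncomputable def coverCoeff (c : Fin N → ℂ) : Fin N → ℂ :=
  setConst (puncturedDiscCover ((monicPoly c).coeff 0)) c

/-- The local inverse of `coverCoeff` sending `coverCoeff c` to `c` when `a` is the constant
coefficient of `c`. -/
noncomputable def sectionCoeff (a : ℂ) (c : Fin N → ℂ) : Fin N → ℂ :=
  setConst (puncturedDiscSection a ((monicPoly c).coeff 0)) c

lemma analyticAt_setConst_comp {s : ℂ → ℂ} {c : Fin N → ℂ}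
    (ha : ‖(monicPoly c).coeff 0‖ < 1) (hs : AnalyticAt ℝ s ((monicPoly c).coeff 0)) :
    AnalyticAt ℝ (fun c : Fin N → ℂ => setConst (s ((monicPoly c).coeff 0)) c) c :=
  AnalyticAt.fun_comp (g := fun p : ℂ × (Fin N → ℂ) => setConst p.1 p.2)
    (f := fun c => (s ((monicPoly c).coeff 0), c)) (analyticAt_setConst ha)
    ((AnalyticAt.fun_comp (g := s) (f := fun c : Fin N → ℂ => (monicPoly c).coeff 0) hs
      (analyticAt_coeff_monicPoly 0 c)).prod analyticAt_id)

include hN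

lemma coverCoeff_mem {c : Fin N → ℂ} (hc : c ∈ discPolys N) :
    coverCoeff c ∈ puncturedDiscPolys N := by
  have ha := norm_coeff_zero_lt_one hN hc
  refine ⟨setConst_mem_discPolys hN hc (norm_puncturedDiscCover_lt_one ha), ?_⟩
  rw [coverCoeff, coeff_zero_setConst ha]
  exact puncturedDiscCover_ne_zero _

lemma sectionCoeff_mem (a : ℂ) {c : Fin N → ℂ} (hc : c ∈ puncturedDiscPolys N) :
    sectionCoeff a c ∈ discPolys N :=
  setConst_mem_discPolys hN hc.1
    (norm_puncturedDiscSection_lt_one a (norm_coeff_zero_lt_one hN hc.1) hc.2)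

lemma coverCoeff_sectionCoeff (a : ℂ) {c : Fin N → ℂ} (hc : c ∈ puncturedDiscPolys N) :
    coverCoeff (sectionCoeff a c) = c := by
  have ha := norm_coeff_zero_lt_one hN hc.1
  rw [coverCoeff, sectionCoeff, coeff_zero_setConst ha,
    setConst_setConst ha (norm_puncturedDiscSection_lt_one a ha hc.2),
    puncturedDiscCover_section a ha hc.2, setConst_coeff_zero ha]

lemma sectionCoeff_coverCoeff {c : Fin N → ℂ} (hc : c ∈ discPolys N) :
    sectionCoeff ((monicPoly c).coeff 0) (coverCoeff c) = c := by
  have ha := norm_coeff_zero_lt_one hN hc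
  rw [coverCoeff, sectionCoeff, coeff_zero_setConst ha,
    setConst_setConst ha (norm_puncturedDiscCover_lt_one ha), puncturedDiscSection_cover ha,
    setConst_coeff_zero ha]

lemma analyticAt_coverCoeff {c : Fin N → ℂ} (hc : c ∈ discPolys N) :
    AnalyticAt ℝ (coverCoeff : (Fin N → ℂ) → _) c := by
  have ha := norm_coeff_zero_lt_one hN hc
  exact analyticAt_setConst_comp ha (analyticAt_puncturedDiscCover (ne_one_of_norm_lt_one ha))

lemma analyticAt_sectionCoeff {c : Fin N → ℂ} (hc : c ∈ discPolys N) :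
    AnalyticAt ℝ (sectionCoeff ((monicPoly c).coeff 0) : (Fin N → ℂ) → _) (coverCoeff c) := by
  have ha := norm_coeff_zero_lt_one hN hc
  have h0 : (monicPoly (coverCoeff c)).coeff 0 = puncturedDiscCover ((monicPoly c).coeff 0) :=
    coeff_zero_setConst ha _
  refine analyticAt_setConst_comp (h0 ▸ norm_puncturedDiscCover_lt_one ha) ?_
  rw [h0]
  exact analyticAt_puncturedDiscSection ha

/-- `coverCoeff` as a map from `discPolys N` to `puncturedDiscPolys N`. -/
noncomputable def coverMap (c : discPolys N) : puncturedDiscPolys N :=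
  ⟨coverCoeff c, coverCoeff_mem hN c.2⟩

/-- The deck transformation of `coverMap` given by the integer `n`. -/
noncomputable def deckMap (n : ℤ) (c : discPolys N) : discPolys N :=
  ⟨setConst (deckDisc n ((monicPoly (c : Fin N → ℂ)).coeff 0)) c,
    setConst_mem_discPolys hN c.2 (norm_deckDisc_lt_one n (norm_coeff_zero_lt_one hN c.2))⟩

lemma coe_deckMap (n : ℤ) (c : discPolys N) : (deckMap hN n c : Fin N → ℂ) =
    setConst (deckDisc n ((monicPoly (c : Fin N → ℂ)).coeff 0)) c := rfl

lemma coeff_zero_deckMap (n : ℤ) (c : discPolys N) :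
    (monicPoly (deckMap hN n c : Fin N → ℂ)).coeff 0 =
      deckDisc n ((monicPoly (c : Fin N → ℂ)).coeff 0) := by
  rw [coe_deckMap, coeff_zero_setConst (norm_coeff_zero_lt_one hN c.2)]

lemma continuous_deckMap (n : ℤ) : Continuous (deckMap hN n) := by
  refine Continuous.subtype_mk (continuous_iff_continuousAt.2 fun c => ?_) _
  have ha := norm_coeff_zero_lt_one hN c.2
  exact ContinuousAt.comp
    (g := fun c : Fin N → ℂ => setConst (deckDisc n ((monicPoly c).coeff 0)) c)
    (analyticAt_setConst_comp ha (analyticAt_deckDisc n ha)).continuousAt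
    continuous_subtype_val.continuousAt

lemma coverMap_eq_iff (c c' : discPolys N) :
    coverMap hN c = coverMap hN c' ↔ ∃ n : ℤ, deckMap hN n c' = c := by
  have ha := norm_coeff_zero_lt_one hN c.2
  have ha' := norm_coeff_zero_lt_one hN c'.2
  constructor
  · intro h
    have h' : coverCoeff (c : Fin N → ℂ) = coverCoeff (c' : Fin N → ℂ) := congrArg Subtype.val h
    have h0 := congrArg (fun c => (monicPoly c).coeff 0) h'
    simp only [coverCoeff, coeff_zero_setConst ha, coeff_zero_setConst ha'] at h0
    obtain ⟨n, hn⟩ := (puncturedDiscCover_eq_iff ha ha').1 h0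
    refine ⟨n, Subtype.ext ?_⟩
    rw [coe_deckMap, hn, ← setConst_setConst ha' (norm_puncturedDiscCover_lt_one ha'), ← coverCoeff,
      ← h', coverCoeff, setConst_setConst ha (norm_puncturedDiscCover_lt_one ha),
      setConst_coeff_zero ha]
  · rintro ⟨n, rfl⟩
    apply Subtype.ext
    change coverCoeff _ = coverCoeff _
    rw [coverCoeff, coverCoeff, coeff_zero_deckMap, coe_deckMap,
      setConst_setConst ha' (norm_deckDisc_lt_one n ha'),
      (puncturedDiscCover_eq_iff (norm_deckDisc_lt_one n ha') ha').2 ⟨n, rfl⟩]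

/-- The action of `ℤ` by deck transformations of `coverMap`. -/
@[reducible]
noncomputable def deckAction : AddAction ℤ (discPolys N) where
  vadd := deckMap hN
  zero_vadd c := by
    have ha := norm_coeff_zero_lt_one hN c.2
    apply Subtype.ext
    change (deckMap hN 0 c : Fin N → ℂ) = c
    rw [coe_deckMap, deckDisc_zero ha, setConst_coeff_zero ha]
  add_vadd m n c := by
    have ha := norm_coeff_zero_lt_one hN c.2
    apply Subtype.ext
    change (deckMap hN (m + n) c : Fin N → ℂ) = deckMap hN m (deckMap hN n c)
    rw [coe_deckMap, coe_deckMap, coeff_zero_deckMap, coe_deckMap,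
      setConst_setConst ha (norm_deckDisc_lt_one n ha), deckDisc_add m n ha]

lemma continuous_coverMap : Continuous (coverMap hN) :=
  Continuous.subtype_mk (continuous_iff_continuousAt.2 fun c =>
    (analyticAt_coverCoeff hN c.2).continuousAt.comp continuous_subtype_val.continuousAt) _

lemma isOpenMap_coverMap : IsOpenMap (coverMap hN) := by
  refine IsOpenMap.of_sections fun c => ⟨fun b => ⟨sectionCoeff
    ((monicPoly (c : Fin N → ℂ)).coeff 0) b, sectionCoeff_mem hN _ b.2⟩, ?_, ?_, ?_⟩
  · exact IsInducing.subtypeVal.continuousAt_iff.2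
      ((analyticAt_sectionCoeff hN c.2).continuousAt.comp
      (f := fun b : puncturedDiscPolys N => (b : Fin N → ℂ)) (x := coverMap hN c)
      continuous_subtype_val.continuousAt)
  · exact Subtype.ext (sectionCoeff_coverCoeff hN c.2)
  · exact fun b => Subtype.ext (coverCoeff_sectionCoeff hN _ b.2)

lemma surjective_coverMap : Function.Surjective (coverMap hN) := fun b =>
  ⟨⟨sectionCoeff 0 b, sectionCoeff_mem hN _ b.2⟩,
    Subtype.ext (coverCoeff_sectionCoeff hN _ b.2)⟩

/-- Applying `deckMap n` adds `2πn` to the imaginary part of `discInvolution` of the constant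
coefficient, so small sets are disjoint from their translates. -/
lemma exists_nhds_disjoint_deckMap (c : discPolys N) :
    ∃ U ∈ 𝓝 c, ∀ n : ℤ, (deckMap hN n '' U ∩ U).Nonempty → n = 0 := by
  let φ : discPolys N → ℝ :=
    fun c => (discInvolution ((monicPoly (c : Fin N → ℂ)).coeff 0)).im
  have hφ : Continuous φ := Complex.continuous_im.comp <| continuous_iff_continuousAt.2 fun c =>
    ContinuousAt.comp (g := discInvolution) (analyticAt_discInvolution
      (ne_one_of_norm_lt_one (norm_coeff_zero_lt_one hN c.2))).continuousAt
      ((continuous_coeff_monicPoly 0).comp continuous_subtype_val).continuousAt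
  refine ⟨φ ⁻¹' Metric.ball (φ c) Real.pi,
    hφ.continuousAt.preimage_mem_nhds (Metric.ball_mem_nhds _ Real.pi_pos), ?_⟩
  rintro n ⟨_, ⟨c', h1, rfl⟩, h2⟩
  have ha := norm_coeff_zero_lt_one hN c'.2
  have h3 : φ (deckMap hN n c') = φ c' + n * (2 * Real.pi) := by
    simp only [φ, coeff_zero_deckMap, discInvolution_deckDisc n ha]
    simp
  simp only [mem_preimage, Metric.mem_ball, Real.dist_eq, h3, abs_lt] at h1 h2
  have hpi := Real.pi_pos
  have hlt : (n : ℝ) < 1 := by nlinarith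
  have hgt : (-1 : ℝ) < n := by nlinarith
  have hlt' : n < 1 := by exact_mod_cast hlt
  have hgt' : -1 < n := by exact_mod_cast hgt
  omega

lemma isAddQuotientCoveringMap_coverMap :
    @IsAddQuotientCoveringMap _ _ _ _ (coverMap hN) ℤ _ (deckAction hN) := by
  let := deckAction hN
  exact
    { toIsQuotientMap := (isOpenMap_coverMap hN).isQuotientMap (continuous_coverMap hN)
        (surjective_coverMap hN)
      continuous_const_vadd := continuous_deckMap hN
      apply_eq_iff_mem_orbit := fun {c c'} => coverMap_eq_iff hN c c'
      disjoint := exists_nhds_disjoint_deckMap hN }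

end Covering

/-! ### Submanifolds with a global analytic parametrization -/

section Parametrization

variable {V V' E F : Type*} [NormedAddCommGroup V] [NormedSpace ℝ V]
  [NormedAddCommGroup V'] [NormedSpace ℝ V'] [NormedAddCommGroup E] [NormedSpace ℝ E]
  [NormedAddCommGroup F] [NormedSpace ℝ F]

/-- `f` is a real analytic parametrization of `S` by the open set `Ω`, with left inverse `g` which
is real analytic on the ambient space near `S`. -/
structure IsAnalyticParametrization (Ω : Set V) (S : Set E) (f : V → E) (g : E → V) : Prop where
  isOpen : IsOpen Ω
  image_eq : f '' Ω = S
  analyticAt : ∀ c ∈ Ω, AnalyticAt ℝ f c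
  analyticAt_inv : ∀ u ∈ S, AnalyticAt ℝ g u
  left_inv : ∀ c ∈ Ω, g (f c) = c

namespace IsAnalyticParametrization

variable {Ω : Set V} {S : Set E} {f : V → E} {g : E → V} {Ω' : Set V'} {T : Set F} {f' : V' → F}
  {g' : F → V'}

lemma apply_mem (h : IsAnalyticParametrization Ω S f g) {c : V} (hc : c ∈ Ω) : f c ∈ S :=
  h.image_eq ▸ mem_image_of_mem f hc

lemma inv_mem (h : IsAnalyticParametrization Ω S f g) {u : E} (hu : u ∈ S) : g u ∈ Ω := by
  rw [← h.image_eq] at hu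
  obtain ⟨c, hc, rfl⟩ := hu
  rwa [h.left_inv c hc]

lemma right_inv (h : IsAnalyticParametrization Ω S f g) {u : E} (hu : u ∈ S) : f (g u) = u := by
  rw [← h.image_eq] at hu
  obtain ⟨c, hc, rfl⟩ := hu
  rw [h.left_inv c hc]

/-- The parametrization as a homeomorphism onto its image. -/
def homeomorph (h : IsAnalyticParametrization Ω S f g) : Ω ≃ₜ S where
  toFun c := ⟨f c, h.apply_mem c.2⟩
  invFun u := ⟨g u, h.inv_mem u.2⟩
  left_inv c := Subtype.ext (h.left_inv c c.2)
  right_inv u := Subtype.ext (h.right_inv u.2)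
  continuous_toFun := Continuous.subtype_mk (continuous_iff_continuousAt.2 fun c : Ω =>
    (h.analyticAt c c.2).continuousAt.comp continuous_subtype_val.continuousAt) _
  continuous_invFun := Continuous.subtype_mk (continuous_iff_continuousAt.2 fun u : S =>
    (h.analyticAt_inv u u.2).continuousAt.comp continuous_subtype_val.continuousAt) _

lemma coe_homeomorph (h : IsAnalyticParametrization Ω S f g) (c : Ω) :
    (h.homeomorph c : E) = f c := rfl

lemma coe_homeomorph_symm (h : IsAnalyticParametrization Ω S f g) (u : S) :
    (h.homeomorph.symm u : V) = g u := rfl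

lemma isAnalyticSubmanifold [FiniteDimensional ℝ V] (h : IsAnalyticParametrization Ω S f g)
    {d : ℕ} (hd : Module.finrank ℝ V = d) : IsAnalyticSubmanifold d S := by
  intro x
  let L : V ≃L[ℝ] EuclideanSpace ℝ (Fin d) :=
    ContinuousLinearEquiv.ofFinrankEq (by rw [hd, finrank_euclideanSpace_fin])
  have hemb : IsOpenEmbedding (fun u : S => L (h.homeomorph.symm u)) :=
    L.toHomeomorph.isOpenEmbedding.comp
      (h.isOpen.isOpenEmbedding_subtypeVal.comp h.homeomorph.symm.isOpenEmbedding)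
  have : Nonempty S := ⟨x⟩
  let e := hemb.toOpenPartialHomeomorph
  have htarget : ∀ y ∈ e.target, L.symm y ∈ Ω := by
    rintro y hy
    rw [hemb.toOpenPartialHomeomorph_target] at hy
    obtain ⟨u, rfl⟩ := hy
    rw [L.symm_apply_apply]
    exact (h.homeomorph.symm u).2
  have hsymm : ∀ y ∈ e.target, (e.symm y : E) = f (L.symm y) := by
    rintro y hy
    rw [hemb.toOpenPartialHomeomorph_target] at hy
    obtain ⟨u, rfl⟩ := hy
    have h1 : e.symm (L (h.homeomorph.symm u)) = u :=
      e.left_inv (x := u) (by simp [e])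
    rw [h1, L.symm_apply_apply, coe_homeomorph_symm, h.right_inv u.2]
  have han : ∀ y ∈ e.target, AnalyticAt ℝ (fun y => f (L.symm y)) y := fun y hy =>
    (h.analyticAt _ (htarget y hy)).fun_comp (L.symm.analyticAt y)
  have hev : ∀ y ∈ e.target, (fun y => (e.symm y : E)) =ᶠ[𝓝 y] fun y => f (L.symm y) :=
    fun y hy => Filter.eventually_of_mem (e.open_target.mem_nhds hy) hsymm
  refine ⟨e, by simp [e], fun y hy => (han y hy).congr (hev y hy).symm, fun y hy => ?_⟩
  rw [(hev y hy).fderiv_eq]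
  -- The chain rule for `g ∘ (f ∘ L⁻¹) = L⁻¹` shows that the derivative is injective.
  have hg : DifferentiableAt ℝ g (f (L.symm y)) :=
    (h.analyticAt_inv _ (h.apply_mem (htarget y hy))).differentiableAt
  have hcomp := fderiv_comp y hg (han y hy).differentiableAt
  have heq : (g ∘ fun y => f (L.symm y)) =ᶠ[𝓝 y] L.symm :=
    Filter.eventually_of_mem (e.open_target.mem_nhds hy) fun z hz => h.left_inv _ (htarget z hz)
  rw [heq.fderiv_eq, L.symm.fderiv] at hcomp
  refine Function.Injective.of_comp (f := fderiv ℝ g (f (L.symm y))) ?_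
  rw [← ContinuousLinearMap.coe_comp, ← hcomp]
  exact L.symm.injective

/-- In analytic parametrizations, an analytic local homeomorphism with analytic local sections is an
analytic local diffeomorphism of the parametrized submanifolds. -/
lemma isAnalyticLocalDiffeo (h : IsAnalyticParametrization Ω S f g)
    (h' : IsAnalyticParametrization Ω' T f' g') {φ : Ω → Ω'} (hφ : IsLocalHomeomorph φ)
    {Φ : V → V'} (hΦ : ∀ c : Ω, (φ c : V') = Φ c) (hΦa : ∀ c ∈ Ω, AnalyticAt ℝ Φ c)
    (hsec : ∀ c : Ω, ∃ (σ : Ω' → Ω) (ψ : V' → V), (∀ b, (σ b : V) = ψ b) ∧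
      AnalyticAt ℝ ψ (φ c) ∧ σ (φ c) = c ∧ ∀ b, φ (σ b) = b) :
    IsAnalyticLocalDiffeo (h'.homeomorph ∘ φ ∘ h.homeomorph.symm) := by
  have hp : IsLocalHomeomorph (h'.homeomorph ∘ φ ∘ h.homeomorph.symm) :=
    h'.homeomorph.isLocalHomeomorph.comp (hφ.comp h.homeomorph.symm.isLocalHomeomorph)
  intro x
  obtain ⟨e, hx, he⟩ := hp x
  have hey (y : S) : e y = h'.homeomorph (φ (h.homeomorph.symm y)) := (congrFun he y).symm
  refine ⟨e, hx, fun y _ => congrFun he y, fun y hy => ⟨fun u => f' (Φ (g u)), ?_, ?_⟩, ?_⟩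
  · have hgy := h.inv_mem y.2
    have h1 : Φ (g y) ∈ Ω' := by
      have := (φ ⟨g y, hgy⟩).2
      rwa [hΦ] at this
    exact (h'.analyticAt _ h1).fun_comp (f := fun u => Φ (g u))
      ((hΦa _ hgy).fun_comp (h.analyticAt_inv y y.2))
  · refine Filter.Eventually.of_forall fun y => ?_
    change (e y : F) = _
    rw [hey, coe_homeomorph, hΦ, coe_homeomorph_symm]
  · intro z hz
    obtain ⟨σ, ψ, hσψ, hψ, hσc, hσ⟩ := hsec (h.homeomorph.symm (e.symm z))
    have hz' : φ (h.homeomorph.symm (e.symm z)) = h'.homeomorph.symm z := by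
      rw [Homeomorph.eq_symm_apply, ← hey, e.right_inv hz]
    rw [hz'] at hψ hσc
    rw [coe_homeomorph_symm] at hψ
    have hψz : ψ (g' z) = h.homeomorph.symm (e.symm z) := by
      rw [← hσc, hσψ, coe_homeomorph_symm]
    -- Near `z` the inverse of `e` is `f ∘ ψ ∘ g'`: both are inverse to `e`, and the latter takes
    -- values in the source of `e` near `z` by continuity.
    refine ⟨fun v => f (ψ (g' v)), ?_, ?_⟩
    · refine AnalyticAt.fun_comp (g := f) (f := fun v => ψ (g' v)) ?_
        (hψ.fun_comp (h'.analyticAt_inv z z.2))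
      rw [hψz]
      exact h.analyticAt _ (h.homeomorph.symm (e.symm z)).2
    · have hcont : ContinuousAt (fun v : T => h.homeomorph (σ (h'.homeomorph.symm v))) z := by
        refine h.homeomorph.continuous.continuousAt.comp
          (IsInducing.subtypeVal.continuousAt_iff.2 ?_)
        have heq : (Subtype.val ∘ fun v : T => σ (h'.homeomorph.symm v)) =
            ψ ∘ fun v : T => (h'.homeomorph.symm v : V') := funext fun v => hσψ _
        rw [heq]
        exact hψ.continuousAt.comp (f := fun v : T => (h'.homeomorph.symm v : V'))
          (continuous_subtype_val.comp h'.homeomorph.symm.continuous).continuousAt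
      have hmem : h.homeomorph (σ (h'.homeomorph.symm z)) ∈ e.source := by
        rw [hσc, Homeomorph.apply_symm_apply]
        exact e.map_target hz
      filter_upwards [hcont.preimage_mem_nhds (e.open_source.mem_nhds hmem)] with v hv
      have hev : e (h.homeomorph (σ (h'.homeomorph.symm v))) = v := by
        rw [hey, Homeomorph.symm_apply_apply, hσ, Homeomorph.apply_symm_apply]
      conv_lhs => rw [← hev, e.left_inv hv]
      rw [coe_homeomorph, hσψ, coe_homeomorph_symm]

end IsAnalyticParametrization

end Parametrization

/-! ### Sums of Poisson kernels on the circle -/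

/-- The inclusion of the circle `ℝ / 2πℤ` into the complex plane. -/
noncomputable def circleCoord : C(AddCircle (2 * Real.pi), ℂ) :=
  ⟨fun y => AddCircle.toCircle y, by fun_prop⟩

lemma circleCoord_apply (y : AddCircle (2 * Real.pi)) :
    circleCoord y = (AddCircle.toCircle y : ℂ) := rfl

lemma norm_circleCoord (y : AddCircle (2 * Real.pi)) : ‖circleCoord y‖ = 1 := by
  exact Circle.norm_coe _

lemma circleCoord_coe (θ : ℝ) : circleCoord (θ : AddCircle (2 * Real.pi)) =
    Complex.exp (θ * Complex.I) := by
  rw [circleCoord_apply, AddCircle.toCircle_apply_mk, Circle.coe_exp,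
    div_self Real.two_pi_pos.ne', one_mul]

/-- The restriction of `monicPoly c` to the circle. -/
noncomputable def circlePoly (c : Fin N → ℂ) : C(AddCircle (2 * Real.pi), ℂ) :=
  circleCoord ^ N + ∑ k : Fin N, c k • circleCoord ^ (k : ℕ)

/-- The restriction of `z P'(z)`, where `P = monicPoly c`, to the circle. -/
noncomputable def circleDerivPoly (c : Fin N → ℂ) : C(AddCircle (2 * Real.pi), ℂ) :=
  (N : ℂ) • circleCoord ^ N + ∑ k : Fin N, c k • ((k : ℕ) : ℂ) • circleCoord ^ (k : ℕ)

/-- The function `2 Re (z P'(z) / P(z)) - N` on the circle, where `P = monicPoly c`. It is the sum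
of the Poisson kernels of the roots of `P`, see `poissonSum_rootCoeff`. -/
noncomputable def poissonSum (c : Fin N → ℂ) : C(AddCircle (2 * Real.pi), ℝ) :=
  Complex.reCLM.compLeftContinuous ℝ _
    ((2 : ℂ) • (circleDerivPoly c * Ring.inverse (circlePoly c))) - ContinuousMap.const _ (N : ℝ)

lemma circlePoly_apply (c : Fin N → ℂ) (y : AddCircle (2 * Real.pi)) :
    circlePoly c y = (monicPoly c).eval (circleCoord y) := by
  simp [circlePoly, eval_monicPoly, ContinuousMap.sum_apply]

lemma circleDerivPoly_apply (c : Fin N → ℂ) (y : AddCircle (2 * Real.pi)) :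
    circleDerivPoly c y = circleCoord y * (monicPoly c).derivative.eval (circleCoord y) := by
  have hpow (k : ℕ) (z : ℂ) : z * (k * z ^ (k - 1)) = k * z ^ k := by
    rcases k with _ | k
    · simp
    · rw [Nat.add_sub_cancel, pow_succ]; ring
  simp only [circleDerivPoly, ContinuousMap.add_apply, ContinuousMap.smul_apply,
    ContinuousMap.pow_apply, ContinuousMap.sum_apply, smul_eq_mul, monicPoly, derivative_add,
    derivative_X_pow, derivative_sum, derivative_C_mul, eval_add, eval_finsetSum, eval_mul,
    eval_C, eval_pow, eval_X, mul_add, hpow, Finset.mul_sum]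
  congr 1
  refine Finset.sum_congr rfl fun k _ => ?_
  rw [mul_left_comm (circleCoord y), hpow, mul_left_comm]

lemma eval_circleCoord_ne_zero {c : Fin N → ℂ} (hc : c ∈ discPolys N)
    (y : AddCircle (2 * Real.pi)) : (monicPoly c).eval (circleCoord y) ≠ 0 := fun h =>
  absurd (hc _ h) (by simp [norm_circleCoord])

lemma isUnit_circlePoly {c : Fin N → ℂ} (hc : c ∈ discPolys N) : IsUnit (circlePoly c) := by
  rw [ContinuousMap.isUnit_iff_forall_ne_zero]
  intro y
  rw [circlePoly_apply]
  exact eval_circleCoord_ne_zero hc y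

lemma poissonSum_apply {c : Fin N → ℂ} (hc : c ∈ discPolys N) (y : AddCircle (2 * Real.pi)) :
    poissonSum c y = 2 * (circleCoord y * (monicPoly c).derivative.eval (circleCoord y) /
      (monicPoly c).eval (circleCoord y)).re - N := by
  have hinv : Ring.inverse (circlePoly c) y = ((monicPoly c).eval (circleCoord y))⁻¹ := by
    have h := congrArg (fun f : C(AddCircle (2 * Real.pi), ℂ) => f y)
      (Ring.mul_inverse_cancel _ (isUnit_circlePoly hc))
    simp only [ContinuousMap.mul_apply, ContinuousMap.one_apply, circlePoly_apply] at h
    exact eq_inv_of_mul_eq_one_right h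
  simp [poissonSum, circleDerivPoly_apply, hinv, div_eq_mul_inv]

lemma eval_derivative_prod_div {ι : Type*} (s : Finset ι) (w : ι → ℂ) {z : ℂ}
    (hz : ∀ j ∈ s, z - w j ≠ 0) :
    (∏ j ∈ s, (X - C (w j))).derivative.eval z / (∏ j ∈ s, (X - C (w j))).eval z =
      ∑ j ∈ s, (z - w j)⁻¹ := by
  classical
  induction s using Finset.induction_on with
  | empty => simp
  | insert i s hi ih =>
    have hs : ∀ j ∈ s, z - w j ≠ 0 := fun j hj => hz j (Finset.mem_insert_of_mem hj)
    have h0 : (∏ j ∈ s, (X - C (w j))).eval z ≠ 0 := by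
      simpa [eval_prod, Finset.prod_eq_zero_iff] using hs
    have hi0 := hz i (Finset.mem_insert_self i s)
    rw [Finset.prod_insert hi, Finset.sum_insert hi, ← ih hs, derivative_mul]
    simp only [derivative_sub, derivative_X, derivative_C, sub_zero, one_mul, eval_add, eval_mul,
      eval_sub, eval_X, eval_C]
    field_simp

lemma sub_ne_zero_of_norm {z w : ℂ} (hz : ‖z‖ = 1) (hw : ‖w‖ < 1) : z - w ≠ 0 := by
  intro h
  rw [sub_eq_zero.1 h] at hz
  exact hw.ne hz

lemma two_mul_re_div_sub {z w : ℂ} (hz : ‖z‖ = 1) (hw : ‖w‖ < 1) :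
    2 * (z * (z - w)⁻¹).re - 1 = (1 - ‖w‖ ^ 2) / ‖z - w‖ ^ 2 := by
  have h0 : Complex.normSq (z - w) ≠ 0 := by
    rw [Ne, Complex.normSq_eq_zero]; exact sub_ne_zero_of_norm hz hw
  have hz' : z.re * z.re + z.im * z.im = 1 := by
    rw [← Complex.normSq_apply, ← Complex.sq_norm, hz, one_pow]
  rw [Complex.sq_norm, Complex.sq_norm, Complex.inv_def, eq_div_iff h0, sub_mul]
  have h1 : (z * (conj (z - w) * ((Complex.normSq (z - w))⁻¹ : ℝ))).re * Complex.normSq (z - w)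
      = (z * conj (z - w)).re := by
    rw [← mul_assoc, Complex.re_mul_ofReal, mul_assoc, inv_mul_cancel₀ h0, mul_one]
  rw [mul_assoc, h1]
  simp only [Complex.normSq_apply, Complex.mul_re, Complex.conj_re, Complex.conj_im,
    Complex.sub_re, Complex.sub_im]
  linear_combination hz'

lemma poissonSum_rootCoeff {w : Fin N → ℂ} (hw : ∀ j, ‖w j‖ < 1) (y : AddCircle (2 * Real.pi)) :
    poissonSum (rootCoeff w) y = ∑ j, (1 - ‖w j‖ ^ 2) / ‖circleCoord y - w j‖ ^ 2 := by
  rw [poissonSum_apply (rootCoeff_mem_discPolys_iff.2 hw), monicPoly_rootCoeff, mul_div_assoc,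
    eval_derivative_prod_div _ _ fun j _ => sub_ne_zero_of_norm (norm_circleCoord y) (hw j),
    Finset.mul_sum, Complex.re_sum, Finset.mul_sum]
  simp_rw [← two_mul_re_div_sub (norm_circleCoord y) (hw _)]
  simp

lemma analyticAt_poissonSum {c : Fin N → ℂ} (hc : c ∈ discPolys N) :
    AnalyticAt ℝ (poissonSum : (Fin N → ℂ) → _) c := by
  have hsum (b : Fin N → C(AddCircle (2 * Real.pi), ℂ)) (a : C(AddCircle (2 * Real.pi), ℂ)) :
      AnalyticAt ℝ (fun c : Fin N → ℂ => a + ∑ k, c k • b k) c := by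
    refine analyticAt_const.add (Finset.analyticAt_fun_sum _ fun k _ => ?_)
    exact ((ContinuousLinearMap.proj (R := ℝ) (φ := fun _ : Fin N => ℂ) k).analyticAt c).smul
      analyticAt_const
  obtain ⟨u, hu⟩ := isUnit_circlePoly hc
  have hinv : AnalyticAt ℝ (fun c : Fin N → ℂ => Ring.inverse (circlePoly c)) c := by
    refine AnalyticAt.fun_comp (g := Ring.inverse) ?_ (hsum _ _)
    rw [← hu]
    exact analyticAt_inverse u
  have hprod : AnalyticAt ℝ (fun c : Fin N → ℂ =>
      (2 : ℂ) • (circleDerivPoly c * Ring.inverse (circlePoly c))) c :=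
    analyticAt_const.fun_smul ((hsum _ _).fun_mul hinv)
  exact ((ContinuousLinearMap.analyticAt _ _).fun_comp hprod).sub analyticAt_const

/-- By Poisson's formula for `z ^ k`, the Fourier coefficients of a sum of Poisson kernels are the
power sums of the roots. -/
lemma integral_poissonSum_mul_pow {w : Fin N → ℂ} (hw : ∀ j, ‖w j‖ < 1) (k : ℕ) :
    ∫ y, (poissonSum (rootCoeff w) y : ℂ) * circleCoord y ^ k ∂AddCircle.haarAddCircle =
      ∑ j, w j ^ k := by
  have hj (j : Fin N) : ∫ y, (((1 - ‖w j‖ ^ 2) / ‖circleCoord y - w j‖ ^ 2 : ℝ) : ℂ) *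
      circleCoord y ^ k ∂AddCircle.haarAddCircle = w j ^ k := by
    have hp := DiffContOnCl.circleAverage_poissonKernel_smul' (R := 1) (c := 0) (w := w j)
      (f := fun z : ℂ => z ^ k) (differentiable_pow k).diffContOnCl (by simpa using hw j)
    rw [← hp, Real.circleAverage, AddCircle.integral_haarAddCircle,
      ← AddCircle.intervalIntegral_preimage (2 * Real.pi) 0, zero_add]
    congr 1
    refine intervalIntegral.integral_congr fun θ _ => ?_
    have : circleMap 0 1 θ = circleCoord (θ : AddCircle (2 * Real.pi)) := by
      rw [circleCoord_coe]; simp [circleMap]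
    simp only [sub_zero, this, norm_circleCoord, one_pow]
    rfl
  simp_rw [poissonSum_rootCoeff hw, Complex.ofReal_sum, Finset.sum_mul]
  rw [integral_finsetSum]
  · exact Finset.sum_congr rfl fun j _ => hj j
  · intro j _
    refine Continuous.integrable_of_hasCompactSupport ?_ (HasCompactSupport.of_compactSpace _)
    refine (Complex.continuous_ofReal.comp (continuous_const.div (by fun_prop) fun y => ?_)).mul
      (by fun_prop)
    exact pow_ne_zero _ (norm_ne_zero_iff.2 (sub_ne_zero_of_norm (norm_circleCoord y) (hw j)))

/-! ### Recovering the coefficients from the power sums of the roots -/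

lemma exists_analytic_esymm (N k : ℕ) (hk : k ≤ N) : ∃ g : (Fin N → ℂ) → ℂ,
    (∀ p, AnalyticAt ℝ g p) ∧ ∀ w : Fin N → ℂ,
      g (fun i => ∑ j, w j ^ ((i : ℕ) + 1)) =
        MvPolynomial.aeval w (MvPolynomial.esymm (Fin N) ℂ k) := by
  induction k using Nat.strong_induction_on with
  | _ k ih =>
    rcases k.eq_zero_or_pos with rfl | hpos
    · exact ⟨fun _ => 1, fun _ => analyticAt_const, fun w => by simp⟩
    · choose! g hg hgw using ih
      have hk0 : (k : ℂ) ≠ 0 := Nat.cast_ne_zero.2 hpos.ne'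
      -- The `m`-th power sum, which is stored at index `m - 1`; only `1 ≤ m ≤ N` occurs below.
      let p' (p : Fin N → ℂ) (m : ℕ) : ℂ := if h : m - 1 < N then p ⟨m - 1, h⟩ else 0
      have hp' (m : ℕ) (p : Fin N → ℂ) : AnalyticAt ℝ (fun p => p' p m) p := by
        by_cases h : m - 1 < N
        · simp only [p', dif_pos h]
          exact (ContinuousLinearMap.proj (R := ℝ) (φ := fun _ : Fin N => ℂ) _).analyticAt p
        · simp only [p', dif_neg h]
          exact analyticAt_const
      refine ⟨fun p => (k : ℂ)⁻¹ * ((-1) ^ (k + 1) *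
        ∑ a ∈ Finset.HasAntidiagonal.antidiagonal k with a.1 < k,
          (-1) ^ a.1 * g a.1 p * p' p a.2), ?_, ?_⟩
      · intro p
        refine analyticAt_const.mul (analyticAt_const.mul
          (Finset.analyticAt_fun_sum _ fun a ha => ?_))
        have hak := (Finset.mem_filter.1 ha).2
        exact (analyticAt_const.mul (hg a.1 hak (by omega) p)).mul (hp' a.2 p)
      · intro w
        have h := congrArg (MvPolynomial.aeval w) (MvPolynomial.mul_esymm_eq_sum (Fin N) ℂ k)
        simp only [map_mul, map_natCast, map_pow, map_neg, map_one, map_sum] at h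
        rw [inv_mul_eq_iff_eq_mul₀ hk0, h]
        congr 1
        refine Finset.sum_congr rfl fun a ha => ?_
        obtain ⟨ha1, hak⟩ := Finset.mem_filter.1 ha
        rw [Finset.HasAntidiagonal.mem_antidiagonal] at ha1
        have h2 : a.2 - 1 < N := by omega
        simp only [p', hgw a.1 hak (by omega) w, dif_pos h2, MvPolynomial.psum, map_sum, map_pow,
          MvPolynomial.aeval_X, Nat.sub_add_cancel (show 1 ≤ a.2 by omega)]

/-- Newton's identities: the coefficients of a monic polynomial are analytic functions of the power
sums of its roots. -/
lemma exists_analytic_rootCoeff (N : ℕ) : ∃ G : (Fin N → ℂ) → (Fin N → ℂ),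
    (∀ p, AnalyticAt ℝ G p) ∧ ∀ w : Fin N → ℂ,
      G (fun i => ∑ j, w j ^ ((i : ℕ) + 1)) = rootCoeff w := by
  choose g hg hgw using fun k : Fin N => exists_analytic_esymm N (N - k) (Nat.sub_le _ _)
  refine ⟨fun p k => (-1) ^ (N - (k : ℕ)) * g k p,
    fun p => AnalyticAt.pi fun k => analyticAt_const.mul (hg k p), fun w => funext fun k => ?_⟩
  have h := Multiset.prod_X_sub_C_coeff (Multiset.map w Finset.univ.val) (k := k)
    (by simp)
  rw [Multiset.map_map] at h
  simp only [Multiset.card_map, Finset.card_val, Finset.card_univ, Fintype.card_fin] at h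
  change _ * g k _ = _
  rw [hgw, MvPolynomial.aeval_esymm_eq_multiset_esymm, ← h]
  rfl

/-- An analytic map sending the power sums `∑ j, w j ^ (i + 1)`, `i < N`, to `rootCoeff w`. -/
noncomputable def newtonMap (N : ℕ) : (Fin N → ℂ) → (Fin N → ℂ) :=
  (exists_analytic_rootCoeff N).choose

lemma analyticAt_newtonMap (p : Fin N → ℂ) : AnalyticAt ℝ (newtonMap N) p :=
  (exists_analytic_rootCoeff N).choose_spec.1 p

lemma newtonMap_powerSum (w : Fin N → ℂ) :
    newtonMap N (fun i => ∑ j, w j ^ ((i : ℕ) + 1)) = rootCoeff w :=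
  (exists_analytic_rootCoeff N).choose_spec.2 w

/-! ### Integration against square integrable functions -/

section Pairing

variable {X : Type*} [MeasurableSpace X] {μ : Measure X}

/-- The continuous linear functional `u ↦ ∫ u φ` on real `L²` for a complex `φ` in `L²`. -/
noncomputable def pairing (φ : X → ℂ) (hφ : MemLp φ 2 μ) : Lp ℝ 2 μ →L[ℝ] ℂ :=
  ((innerSL ℂ (hφ.star.toLp (star φ))).restrictScalars ℝ).comp (Complex.ofRealCLM.compLpL 2 μ)

lemma pairing_apply {φ : X → ℂ} (hφ : MemLp φ 2 μ) (u : Lp ℝ 2 μ) :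
    pairing φ hφ u = ∫ x, (u x : ℂ) * φ x ∂μ := by
  change inner ℂ (hφ.star.toLp (star φ)) (Complex.ofRealCLM.compLpL 2 μ u) = _
  rw [L2.inner_def]
  refine integral_congr_ae ?_
  filter_upwards [hφ.star.coeFn_toLp, Complex.ofRealCLM.coeFn_compLpL u] with x h1 h2
  rw [h1, h2]
  simp [mul_comm]

end Pairing

/-! ### The finite gap potentials -/

/-- The potential on the torus attached to the polynomial with coefficients `c`. -/
noncomputable def gapParam (c : Fin N → ℂ) :
    Lp ℝ 2 (AddCircle.haarAddCircle : Measure (AddCircle (2 * Real.pi))) :=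
  ContinuousMap.toLp 2 AddCircle.haarAddCircle ℝ
    (poissonSum c - ContinuousMap.const _ (N : ℝ))

lemma memLp_circleCoord_pow (k : ℕ) :
    MemLp (fun y => circleCoord y ^ k) 2 AddCircle.haarAddCircle :=
  MemLp.of_bound (by fun_prop) 1 (Filter.Eventually.of_forall fun y => by simp [norm_circleCoord])

/-- The left inverse of `gapParam`, by Newton's identities applied to Fourier coefficients. -/
noncomputable def gapParamInv (N : ℕ)
    (v : Lp ℝ 2 (AddCircle.haarAddCircle : Measure (AddCircle (2 * Real.pi)))) : Fin N → ℂ :=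
  newtonMap N fun i => pairing _ (memLp_circleCoord_pow ((i : ℕ) + 1)) v

lemma integrable_continuous_haarAddCircle {f : AddCircle (2 * Real.pi) → ℂ} (hf : Continuous f) :
    Integrable f AddCircle.haarAddCircle :=
  hf.integrable_of_hasCompactSupport (HasCompactSupport.of_compactSpace _)

/-- Poisson's formula for the single root `0`, whose Poisson kernel is `1`. -/
lemma integral_circleCoord_pow {k : ℕ} (hk : 0 < k) :
    ∫ y, circleCoord y ^ k ∂AddCircle.haarAddCircle = 0 := by
  have h := integral_poissonSum_mul_pow (N := 1) (w := 0) (by simp) k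
  simp only [poissonSum_rootCoeff (N := 1) (w := 0) (by simp)] at h
  simpa [norm_circleCoord, hk.ne'] using h

lemma gapParamInv_gapParam {c : Fin N → ℂ} (hc : c ∈ discPolys N) :
    gapParamInv N (gapParam c) = c := by
  obtain ⟨w, hw, rfl⟩ := exists_roots_of_mem_discPolys hc
  rw [gapParamInv]
  conv_rhs => rw [← newtonMap_powerSum]
  congr 1
  funext i
  rw [pairing_apply, ← integral_poissonSum_mul_pow hw]
  have h1 : ∫ y, ((gapParam (rootCoeff w) y : ℝ) : ℂ) * circleCoord y ^ ((i : ℕ) + 1)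
      ∂AddCircle.haarAddCircle = ∫ y, ((poissonSum (rootCoeff w) y : ℂ) *
        circleCoord y ^ ((i : ℕ) + 1) - N * circleCoord y ^ ((i : ℕ) + 1))
        ∂AddCircle.haarAddCircle := by
    refine integral_congr_ae ?_
    filter_upwards [ContinuousMap.coeFn_toLp (𝕜 := ℝ) (p := 2) AddCircle.haarAddCircle
      (poissonSum (rootCoeff w) - ContinuousMap.const _ (N : ℝ))] with y hy
    rw [gapParam, hy]
    simp [sub_mul]
  rw [h1, integral_sub (integrable_continuous_haarAddCircle (by fun_prop))
    (integrable_continuous_haarAddCircle (by fun_prop)), integral_const_mul,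
    integral_circleCoord_pow (Nat.succ_pos _), mul_zero, sub_zero]

/-- Reflection of a pole in the unit circle. -/
lemma conj_mul_inv_sub_one {ζ z : ℂ} (hζ : ‖ζ‖ = 1) (hz : 1 < ‖z‖) :
    conj (ζ * (ζ - (conj z)⁻¹)⁻¹) - 1 = -(ζ * (ζ - z)⁻¹) := by
  have hz0 : z ≠ 0 := by rintro rfl; simp at hz; linarith
  have h1 : ζ - z ≠ 0 := by
    intro h
    rw [sub_eq_zero.1 h] at hζ
    exact hz.ne' hζ
  have h2 : conj ζ * ζ = 1 := by
    rw [mul_comm, Complex.mul_conj, ← Complex.sq_norm, hζ]; simp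
  have h3 : conj ζ * z - 1 ≠ 0 := by
    intro h
    apply h1
    linear_combination z * h2 - ζ * h
  have h4 : conj ζ - z⁻¹ = (conj ζ * z - 1) / z := by field_simp
  simp only [map_mul, map_inv₀, map_sub, Complex.conj_conj]
  rw [h4]
  field_simp
  linear_combination h2 * z

lemma gapFunction_add_conj {z : Fin N → ℂ} (hz : ∀ j, 1 < ‖z j‖) (y : AddCircle (2 * Real.pi)) :
    gapFunction (∏ j, (X - C (z j))) y + conj (gapFunction (∏ j, (X - C (z j))) y) =
      ((poissonSum (rootCoeff fun j => (conj (z j))⁻¹) y - N : ℝ) : ℂ) := by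
  have hw (j : Fin N) : ‖(conj (z j))⁻¹‖ < 1 := by
    rw [norm_inv, RCLike.norm_conj]; exact inv_lt_one_of_one_lt₀ (hz j)
  have hne (j : Fin N) : circleCoord y - z j ≠ 0 := by
    intro h
    have := hz j
    rw [← sub_eq_zero.1 h, norm_circleCoord] at this
    exact lt_irrefl _ this
  have hgap : gapFunction (∏ j, (X - C (z j))) y =
      ∑ j, -(circleCoord y * (circleCoord y - z j)⁻¹) := by
    rw [gapFunction, ← circleCoord_apply, mul_div_assoc,
      eval_derivative_prod_div _ _ fun j _ => hne j, Finset.mul_sum]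
    simp
  rw [Complex.add_conj, hgap, poissonSum_rootCoeff hw]
  congr 1
  simp_rw [← two_mul_re_div_sub (norm_circleCoord y) (hw _),
    ← conj_mul_inv_sub_one (norm_circleCoord y) (hz _)]
  simp only [Complex.re_sum, Complex.sub_re, Complex.conj_re, Complex.one_re, Finset.mul_sum,
    Finset.sum_sub_distrib, mul_sub]
  simp
  ring

lemma eq_gapParam_iff {z : Fin N → ℂ} (hz : ∀ j, 1 < ‖z j‖)
    (v : Lp ℝ 2 (AddCircle.haarAddCircle : Measure (AddCircle (2 * Real.pi)))) :
    gapParam (rootCoeff fun j => (conj (z j))⁻¹) = v ↔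
      ∀ᵐ y ∂(AddCircle.haarAddCircle : Measure (AddCircle (2 * Real.pi))),
        ((v y : ℝ) : ℂ) = gapFunction (∏ j, (X - C (z j))) y +
          conj (gapFunction (∏ j, (X - C (z j))) y) := by
  simp_rw [gapFunction_add_conj hz, Complex.ofReal_inj]
  have h := ContinuousMap.coeFn_toLp (𝕜 := ℝ) (p := 2) AddCircle.haarAddCircle
      (poissonSum (rootCoeff fun j => (conj (z j))⁻¹) - ContinuousMap.const _ (N : ℝ))
  constructor
  · rintro rfl
    exact h
  · exact fun hv => Lp.ext (h.trans (Filter.EventuallyEq.symm hv))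

lemma image_gapParam (N : ℕ) : gapParam '' puncturedDiscPolys N = gapManifold N := by
  ext v
  constructor
  · rintro ⟨c, hc, rfl⟩
    obtain ⟨w, rfl⟩ := exists_eq_rootCoeff c
    obtain ⟨hw, hw0⟩ := rootCoeff_mem_puncturedDiscPolys_iff.1 hc
    have hz (j : Fin N) : 1 < ‖(conj (w j))⁻¹‖ := by
      rw [norm_inv, RCLike.norm_conj]
      exact (one_lt_inv₀ (norm_pos_iff.2 (hw0 j))).2 (hw j)
    refine ⟨∏ j, (X - C (conj (w j))⁻¹), monic_prod_X_sub_C _ _, by simp, ?_, ?_⟩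
    · intro z hroot
      simp only [IsRoot, eval_prod, eval_sub, eval_X, eval_C, Finset.prod_eq_zero_iff,
        Finset.mem_univ, true_and, sub_eq_zero] at hroot
      obtain ⟨j, rfl⟩ := hroot
      exact hz j
    · exact (eq_gapParam_iff hz _).1 (by simp)
  · rintro ⟨Q, hQ, hQN, hroot, hv⟩
    obtain ⟨z, rfl⟩ := exists_prod_X_sub_C hQ hQN
    have hz (j : Fin N) : 1 < ‖z j‖ := by
      refine hroot _ ?_
      simp only [IsRoot, eval_prod, eval_sub, eval_X, eval_C, Finset.prod_eq_zero_iff,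
        Finset.mem_univ, true_and, sub_eq_zero]
      exact ⟨j, rfl⟩
    refine ⟨_, rootCoeff_mem_puncturedDiscPolys_iff.2 ⟨fun j => ?_, fun j => ?_⟩,
      (eq_gapParam_iff hz v).2 hv⟩
    · rw [norm_inv, RCLike.norm_conj]; exact inv_lt_one_of_one_lt₀ (hz j)
    · have : z j ≠ 0 := norm_pos_iff.1 (one_pos.trans (hz j))
      simpa using this

lemma isAnalyticParametrization_gapManifold (N : ℕ) :
    IsAnalyticParametrization (puncturedDiscPolys N) (gapManifold N) gapParam (gapParamInv N) where
  isOpen := isOpen_puncturedDiscPolys N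
  image_eq := image_gapParam N
  analyticAt _ hc := (ContinuousLinearMap.analyticAt _ _).fun_comp
    ((analyticAt_poissonSum hc.1).sub analyticAt_const)
  analyticAt_inv v _ := (analyticAt_newtonMap _).fun_comp
    (AnalyticAt.pi fun _ => ContinuousLinearMap.analyticAt _ v)
  left_inv _ hc := gapParamInv_gapParam hc.1

/-! ### The multi-solitons -/

/-- The Cayley transform of the line onto the circle without the point `-1`, as an angle:
`e ^ {2 i arctan x} = (1 + i x) / (1 - i x)`. -/
noncomputable def lineAngle (x : ℝ) : AddCircle (2 * Real.pi) := ((2 * Real.arctan x : ℝ) : _)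

lemma continuous_lineAngle : Continuous lineAngle :=
  (AddCircle.continuous_mk' _).comp (continuous_const.mul Real.continuous_arctan)

lemma one_sub_I_mul_ne_zero {ζ : ℂ} (hζ : 0 ≤ ζ.im) : 1 - Complex.I * ζ ≠ 0 := by
  intro h
  have := congrArg Complex.re h
  simp at this
  linarith

lemma circleCoord_lineAngle (x : ℝ) :
    circleCoord (lineAngle x) = (1 + Complex.I * x) / (1 - Complex.I * x) := by
  have h0 := one_sub_I_mul_ne_zero (ζ := x) (by simp)
  have hx : (0 : ℝ) < 1 + x ^ 2 := by positivity
  have hs : ((√(1 + x ^ 2) : ℝ) : ℂ) ^ 2 = 1 + (x : ℂ) ^ 2 := by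
    rw [← Complex.ofReal_pow, Real.sq_sqrt hx.le]; simp
  have hs0 : ((√(1 + x ^ 2) : ℝ) : ℂ) ≠ 0 := by
    exact_mod_cast (Real.sqrt_pos.2 hx).ne'
  have hexp : Complex.exp (Real.arctan x * Complex.I) =
      (1 + Complex.I * x) / (√(1 + x ^ 2) : ℝ) := by
    rw [Complex.exp_mul_I, ← Complex.ofReal_cos, ← Complex.ofReal_sin, Real.cos_arctan,
      Real.sin_arctan]
    push_cast
    field_simp
  rw [lineAngle, circleCoord_coe]
  have h2 : ((2 * Real.arctan x : ℝ) : ℂ) * Complex.I =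
      Real.arctan x * Complex.I + Real.arctan x * Complex.I := by push_cast; ring
  rw [h2, Complex.exp_add, hexp, div_mul_div_comm, ← sq (Complex.ofReal _), hs, div_eq_div_iff]
  · linear_combination (-(1 + Complex.I * x) * x ^ 2) * Complex.I_sq
  · rw [← hs]; exact pow_ne_zero _ hs0
  · exact h0

/-- The change of variables `θ = 2 arctan x`. -/
lemma integral_lineAngle (f : AddCircle (2 * Real.pi) → ℂ) :
    ∫ x : ℝ, ((2 / (1 + x ^ 2) : ℝ) : ℂ) * f (lineAngle x) =
      2 * Real.pi * ∫ y, f y ∂AddCircle.haarAddCircle := by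
  have himg : (fun x => 2 * Real.arctan x) '' univ = Ioo (-Real.pi) Real.pi := by
    rw [image_univ]
    ext θ
    simp only [mem_range, mem_Ioo]
    constructor
    · rintro ⟨x, rfl⟩
      have := Real.neg_pi_div_two_lt_arctan x
      have := Real.arctan_lt_pi_div_two x
      constructor <;> linarith
    · rintro ⟨h1, h2⟩
      exact ⟨Real.tan (θ / 2), by
        rw [Real.arctan_tan (by linarith) (by linarith)]; ring⟩
  have h := integral_image_eq_integral_abs_deriv_smul (s := univ)
    (f := fun x => 2 * Real.arctan x) (f' := fun x => 2 * (1 / (1 + x ^ 2))) MeasurableSet.univ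
    (fun x _ => ((Real.hasDerivAt_arctan x).const_mul 2).hasDerivWithinAt)
    (fun x _ y _ hxy => Real.arctan_injective (by simpa using hxy))
    (fun θ => f (θ : AddCircle (2 * Real.pi)))
  have hper := AddCircle.intervalIntegral_preimage (2 * Real.pi) (-Real.pi) f
  rw [show -Real.pi + 2 * Real.pi = Real.pi by ring, intervalIntegral.integral_of_le
    (by linarith [Real.pi_pos]), integral_Ioc_eq_integral_Ioo, ← himg, h, setIntegral_univ] at hper
  have hpi : (2 * Real.pi : ℂ) ≠ 0 := by exact_mod_cast Real.two_pi_pos.ne'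
  rw [AddCircle.integral_haarAddCircle, ← hper, Complex.real_smul, ← mul_assoc]
  push_cast
  rw [mul_inv_cancel₀ hpi, one_mul]
  refine integral_congr_ae (Filter.Eventually.of_forall fun x => ?_)
  have hx : (0 : ℝ) ≤ 2 * (1 / (1 + x ^ 2)) := by positivity
  simp only [abs_of_nonneg hx, Complex.real_smul, lineAngle]
  push_cast
  ring

lemma memLp_two_div_one_add_sq : MemLp (fun x : ℝ => 2 / (1 + x ^ 2)) 2 volume := by
  have hcont : Continuous fun x : ℝ => 2 / (1 + x ^ 2) :=
    continuous_const.div (by fun_prop) fun x => by positivity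
  rw [memLp_two_iff_integrable_sq hcont.aestronglyMeasurable]
  refine (integrable_inv_one_add_sq.const_mul 4).mono' (hcont.pow 2).aestronglyMeasurable
    (Filter.Eventually.of_forall fun x => ?_)
  have hx : (1 : ℝ) ≤ 1 + x ^ 2 := by nlinarith [sq_nonneg x]
  rw [Real.norm_of_nonneg (by positivity), div_pow, div_eq_mul_inv]
  have : ((1 + x ^ 2) ^ 2)⁻¹ ≤ (1 + x ^ 2)⁻¹ :=
    inv_anti₀ (by positivity) (by nlinarith)
  linarith

lemma memLp_lineTransfer (f : C(AddCircle (2 * Real.pi), ℝ)) :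
    MemLp (fun x : ℝ => 2 / (1 + x ^ 2) * f (lineAngle x)) 2 volume := by
  refine memLp_two_div_one_add_sq.of_le_mul (c := ‖f‖) ?_ (Filter.Eventually.of_forall fun x => ?_)
  · exact ((continuous_const.div (by fun_prop) fun x => by positivity).mul
      (f.continuous.comp continuous_lineAngle)).aestronglyMeasurable
  · rw [norm_mul, mul_comm]
    exact mul_le_mul_of_nonneg_right (f.norm_coe_le_norm _) (norm_nonneg _)

/-- The bounded operator taking a function on the circle to `x ↦ 2 / (1 + x ^ 2) f(2 arctan x)`. -/
noncomputable def lineTransfer :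
    C(AddCircle (2 * Real.pi), ℝ) →L[ℝ] Lp ℝ 2 (volume : Measure ℝ) :=
  LinearMap.mkContinuous
    { toFun f := (memLp_lineTransfer f).toLp _
      map_add' f g := by
        rw [← MemLp.toLp_add]
        exact MemLp.toLp_congr _ _ (Filter.Eventually.of_forall fun x => by simp [mul_add])
      map_smul' a f := by
        rw [RingHom.id_apply, ← MemLp.toLp_const_smul]
        exact MemLp.toLp_congr _ _ (Filter.Eventually.of_forall fun x => by
          simp [mul_left_comm]) }
    ‖memLp_two_div_one_add_sq.toLp _‖ fun f => by
      refine (Lp.norm_le_mul_norm_of_ae_le_mul (c := ‖f‖) ?_).trans_eq (mul_comm _ _)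
      filter_upwards [(memLp_lineTransfer f).coeFn_toLp, memLp_two_div_one_add_sq.coeFn_toLp]
        with x h1 h2
      rw [LinearMap.coe_mk, AddHom.coe_mk, h1, h2, norm_mul, mul_comm]
      exact mul_le_mul_of_nonneg_right (f.norm_coe_le_norm _) (norm_nonneg _)

lemma coeFn_lineTransfer (f : C(AddCircle (2 * Real.pi), ℝ)) :
    lineTransfer f =ᵐ[volume] fun x => 2 / (1 + x ^ 2) * f (lineAngle x) :=
  (memLp_lineTransfer f).coeFn_toLp

/-- The potential on the line attached to the polynomial with coefficients `c`. -/
noncomputable def solitonParam (c : Fin N → ℂ) : Lp ℝ 2 (volume : Measure ℝ) :=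
  lineTransfer (poissonSum c)

lemma norm_pow_sub_pow_le {a b : ℂ} (ha : ‖a‖ = 1) (hb : ‖b‖ = 1) (k : ℕ) :
    ‖a ^ k - b ^ k‖ ≤ k * ‖a - b‖ := by
  induction k with
  | zero => simp
  | succ k ih =>
    calc ‖a ^ (k + 1) - b ^ (k + 1)‖ = ‖a ^ k * (a - b) + (a ^ k - b ^ k) * b‖ := by ring_nf
      _ ≤ ‖a ^ k * (a - b)‖ + ‖(a ^ k - b ^ k) * b‖ := norm_add_le _ _
      _ = ‖a - b‖ + ‖a ^ k - b ^ k‖ := by simp [ha, hb]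
      _ ≤ (k + 1 : ℕ) * ‖a - b‖ := by push_cast; linarith

/-- Subtracting the value at `x = ∞` makes the powers of the Cayley transform square integrable. -/
lemma memLp_lineAngle_pow_sub (k : ℕ) :
    MemLp (fun x : ℝ => circleCoord (lineAngle x) ^ k - (-1) ^ k) 2 volume := by
  have hcont (k : ℕ) : Continuous fun x : ℝ => circleCoord (lineAngle x) ^ k - (-1) ^ k :=
    ((circleCoord.continuous.comp continuous_lineAngle).pow k).sub continuous_const
  have h1 : MemLp (fun x : ℝ => circleCoord (lineAngle x) ^ 1 - (-1) ^ 1) 2 volume := by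
    rw [memLp_two_iff_integrable_sq_norm (hcont 1).aestronglyMeasurable]
    refine (integrable_inv_one_add_sq.const_mul 4).congr (Filter.Eventually.of_forall fun x => ?_)
    have h0 := one_sub_I_mul_ne_zero (ζ := x) (by simp)
    have h2 : circleCoord (lineAngle x) ^ 1 - (-1) ^ 1 = 2 / (1 - Complex.I * x) := by
      rw [circleCoord_lineAngle, pow_one, pow_one]
      field_simp
      ring
    have h3 : ‖1 - Complex.I * x‖ ^ 2 = 1 + x ^ 2 := by
      rw [Complex.sq_norm, Complex.normSq_apply]; simp; ring
    beta_reduce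
    rw [h2, norm_div, div_pow, h3, div_eq_mul_inv]
    norm_num
  refine h1.of_le_mul (c := k) (hcont k).aestronglyMeasurable
    (Filter.Eventually.of_forall fun x => ?_)
  rw [pow_one, pow_one]
  exact norm_pow_sub_pow_le (norm_circleCoord _) (by simp) k

/-- The left inverse of `solitonParam`, by Newton's identities applied to the integrals
against the functions of `memLp_lineAngle_pow_sub`. -/
noncomputable def solitonParamInv (N : ℕ) (u : Lp ℝ 2 (volume : Measure ℝ)) : Fin N → ℂ :=
  newtonMap N fun i =>
    (2 * Real.pi : ℂ)⁻¹ * pairing _ (memLp_lineAngle_pow_sub ((i : ℕ) + 1)) u +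
      (-1) ^ ((i : ℕ) + 1) * N

lemma solitonParamInv_solitonParam {c : Fin N → ℂ} (hc : c ∈ discPolys N) :
    solitonParamInv N (solitonParam c) = c := by
  obtain ⟨w, hw, rfl⟩ := exists_roots_of_mem_discPolys hc
  rw [solitonParamInv]
  conv_rhs => rw [← newtonMap_powerSum]
  congr 1
  funext i
  have hpi : (2 * Real.pi : ℂ) ≠ 0 := by exact_mod_cast Real.two_pi_pos.ne'
  have h1 : ∫ x : ℝ, ((solitonParam (rootCoeff w) x : ℝ) : ℂ) *
      (circleCoord (lineAngle x) ^ ((i : ℕ) + 1) - (-1) ^ ((i : ℕ) + 1)) =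
      ∫ x : ℝ, ((2 / (1 + x ^ 2) : ℝ) : ℂ) * ((poissonSum (rootCoeff w) (lineAngle x) : ℂ) *
        circleCoord (lineAngle x) ^ ((i : ℕ) + 1) -
          (poissonSum (rootCoeff w) (lineAngle x) : ℂ) * (-1) ^ ((i : ℕ) + 1)) := by
    refine integral_congr_ae ?_
    filter_upwards [coeFn_lineTransfer (poissonSum (rootCoeff w))] with x hx
    rw [solitonParam, hx]
    push_cast
    ring
  have h0 := integral_poissonSum_mul_pow hw 0
  simp only [pow_zero, mul_one, Finset.sum_const, Finset.card_univ, Fintype.card_fin,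
    nsmul_eq_mul] at h0
  rw [pairing_apply, h1, integral_lineAngle (fun y => (poissonSum (rootCoeff w) y : ℂ) *
        circleCoord y ^ ((i : ℕ) + 1) - (poissonSum (rootCoeff w) y : ℂ) * (-1) ^ ((i : ℕ) + 1)),
    integral_sub (integrable_continuous_haarAddCircle (by fun_prop))
      (integrable_continuous_haarAddCircle (by fun_prop)), integral_mul_const,
    integral_poissonSum_mul_pow hw, h0, inv_mul_cancel_left₀ hpi]
  ring

/-- The Cayley transform of the upper half-plane onto the unit disc. -/
noncomputable def cayley (ζ : ℂ) : ℂ := (1 + Complex.I * ζ) / (1 - Complex.I * ζ)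

lemma one_sub_norm_cayley_sq {ζ : ℂ} (hζ : 0 < ζ.im) :
    1 - ‖cayley ζ‖ ^ 2 = 4 * ζ.im / ‖1 - Complex.I * ζ‖ ^ 2 := by
  have h0 : ‖1 - Complex.I * ζ‖ ^ 2 ≠ 0 :=
    pow_ne_zero _ (norm_ne_zero_iff.2 (one_sub_I_mul_ne_zero hζ.le))
  rw [cayley, norm_div, div_pow, eq_div_iff h0, sub_mul, div_mul_cancel₀ _ h0, Complex.sq_norm,
    Complex.sq_norm, Complex.normSq_apply, Complex.normSq_apply]
  simp
  ring

lemma norm_cayley_lt_one {ζ : ℂ} (hζ : 0 < ζ.im) : ‖cayley ζ‖ < 1 := by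
  have h0 : 0 < ‖1 - Complex.I * ζ‖ := norm_pos_iff.2 (one_sub_I_mul_ne_zero hζ.le)
  have h1 := one_sub_norm_cayley_sq hζ
  have h2 : 0 < 4 * ζ.im / ‖1 - Complex.I * ζ‖ ^ 2 := by positivity
  nlinarith [norm_nonneg (cayley ζ)]

lemma exists_cayley_eq {w : ℂ} (hw : ‖w‖ < 1) : ∃ ζ : ℂ, 0 < ζ.im ∧ cayley ζ = w := by
  have h0 : 1 + w ≠ 0 := by
    intro h
    rw [eq_neg_of_add_eq_zero_right h] at hw
    simp at hw
  have h1 : 0 < Complex.normSq (1 + w) := Complex.normSq_pos.2 h0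
  have h2 : ‖w‖ ^ 2 < 1 := by nlinarith [norm_nonneg w]
  rw [Complex.sq_norm, Complex.normSq_apply] at h2
  refine ⟨Complex.I * ((1 - w) / (1 + w)), ?_, ?_⟩
  · rw [Complex.I_mul_im, Complex.div_re, ← add_div]
    refine div_pos ?_ h1
    simp
    nlinarith
  · have h3 : 1 + Complex.I * (Complex.I * ((1 - w) / (1 + w))) = 2 * w / (1 + w) := by
      rw [← mul_assoc, Complex.I_mul_I]; field_simp; ring
    have h4 : 1 - Complex.I * (Complex.I * ((1 - w) / (1 + w))) = 2 / (1 + w) := by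
      rw [← mul_assoc, Complex.I_mul_I]; field_simp; ring
    rw [cayley, h3, h4]
    field_simp

/-- Conformal invariance of the Poisson kernel. -/
lemma poissonKernel_lineAngle {ζ : ℂ} (hζ : 0 < ζ.im) (x : ℝ) :
    2 / (1 + x ^ 2) * ((1 - ‖cayley ζ‖ ^ 2) / ‖circleCoord (lineAngle x) - cayley ζ‖ ^ 2) =
      2 * ζ.im / ‖(x : ℂ) - ζ‖ ^ 2 := by
  have h1 := one_sub_I_mul_ne_zero hζ.le
  have h2 := one_sub_I_mul_ne_zero (ζ := x) (by simp)
  have h3 : circleCoord (lineAngle x) - cayley ζ =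
      2 * Complex.I * (x - ζ) / ((1 - Complex.I * x) * (1 - Complex.I * ζ)) := by
    rw [circleCoord_lineAngle, cayley, div_sub_div _ _ h2 h1]
    congr 1
    ring
  have h4 : ‖1 - Complex.I * x‖ ^ 2 = 1 + x ^ 2 := by
    rw [Complex.sq_norm, Complex.normSq_apply]; simp; ring
  have h5 : (x : ℂ) - ζ ≠ 0 := by
    intro h
    have := congrArg Complex.im h
    simp at this
    exact hζ.ne' this
  have h6 : ‖(x : ℂ) - ζ‖ ≠ 0 := norm_ne_zero_iff.2 h5
  have h7 : ‖1 - Complex.I * ζ‖ ≠ 0 := norm_ne_zero_iff.2 h1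
  have h8 : (1 + x ^ 2 : ℝ) ≠ 0 := by positivity
  rw [one_sub_norm_cayley_sq hζ, h3, norm_div, norm_mul, norm_mul, norm_mul, div_pow, mul_pow,
    mul_pow, mul_pow, h4, Complex.norm_I, RCLike.norm_ofNat]
  field_simp
  ring

lemma scaledProfile_eq {c : ℝ} (hc : 0 < c) (a x : ℝ) :
    scaledProfile c (x - a) =
      2 * (a + Complex.I / c : ℂ).im / ‖(x : ℂ) - (a + Complex.I / c)‖ ^ 2 := by
  have him : (a + Complex.I / c : ℂ).im = 1 / c := by simp
  have hre : (a + Complex.I / c : ℂ).re = a := by simp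
  rw [Complex.sq_norm, Complex.normSq_apply, Complex.sub_re, Complex.sub_im, him, hre,
    Complex.ofReal_re, Complex.ofReal_im, scaledProfile, solitonProfile]
  have h1 : 1 + (c * (x - a)) ^ 2 ≠ 0 := by positivity
  have h2 : (x - a) * (x - a) + (0 - 1 / c) * (0 - 1 / c) ≠ 0 := by
    have : 0 < (0 - 1 / c) * (0 - 1 / c) := by
      rw [zero_sub, neg_mul_neg]; positivity
    nlinarith [mul_self_nonneg (x - a)]
  rw [eq_div_iff h2]
  field_simp
  ring

lemma solitonParam_ae_eq {c a : Fin N → ℝ} (hc : ∀ j, 0 < c j) :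
    solitonParam (rootCoeff fun j => cayley (a j + Complex.I / c j)) =ᵐ[volume]
      fun x => ∑ j, scaledProfile (c j) (x - a j) := by
  have him (j : Fin N) : 0 < (a j + Complex.I / c j : ℂ).im := by simpa using hc j
  filter_upwards [coeFn_lineTransfer
    (poissonSum (rootCoeff fun j => cayley (a j + Complex.I / c j)))] with x hx
  rw [solitonParam, hx, poissonSum_rootCoeff fun j => norm_cayley_lt_one (him j), Finset.mul_sum]
  exact Finset.sum_congr rfl fun j _ => by
    rw [poissonKernel_lineAngle (him j), scaledProfile_eq (hc j)]

lemma image_solitonParam (N : ℕ) : solitonParam '' discPolys N = solitonManifold N := by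
  ext u
  constructor
  · rintro ⟨p, hp, rfl⟩
    obtain ⟨w, hw, rfl⟩ := exists_roots_of_mem_discPolys hp
    choose ζ hζ hζw using fun j => exists_cayley_eq (hw j)
    have heq (j : Fin N) : w j = cayley ((ζ j).re + Complex.I / ((ζ j).im⁻¹ : ℝ)) := by
      rw [← hζw j]
      congr 1
      conv_lhs => rw [← Complex.re_add_im (ζ j)]
      push_cast
      rw [div_inv_eq_mul, mul_comm]
    have hc (j : Fin N) : 0 < (ζ j).im⁻¹ := inv_pos.2 (hζ j)
    refine ⟨fun j => (ζ j).im⁻¹, fun j => (ζ j).re, hc, ?_⟩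
    rw [funext heq]
    exact solitonParam_ae_eq hc
  · rintro ⟨c, a, hc, hu⟩
    refine ⟨_, rootCoeff_mem_discPolys_iff.2 fun j => norm_cayley_lt_one
      (ζ := a j + Complex.I / c j) (by simpa using hc j), ?_⟩
    exact Lp.ext ((solitonParam_ae_eq hc).trans (Filter.EventuallyEq.symm hu))

lemma isAnalyticParametrization_solitonManifold (N : ℕ) :
    IsAnalyticParametrization (discPolys N) (solitonManifold N) solitonParam
      (solitonParamInv N) where
  isOpen := isOpen_discPolys N
  image_eq := image_solitonParam N
  analyticAt _ hc := (ContinuousLinearMap.analyticAt _ _).fun_comp (analyticAt_poissonSum hc)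
  analyticAt_inv u _ := (analyticAt_newtonMap _).fun_comp
    (AnalyticAt.pi fun _ => (analyticAt_const.fun_mul (ContinuousLinearMap.analyticAt _ u)).fun_add
      analyticAt_const)
  left_inv _ hc := solitonParamInv_solitonParam hc

/-! ### The universal covering -/

lemma isUniversalCoveringManifold {N : ℕ} (hN : 0 < N) :
    IsUniversalCoveringManifold (2 * N) (solitonManifold N) (gapManifold N) := by
  have hS := isAnalyticParametrization_solitonManifold N
  have hT := isAnalyticParametrization_gapManifold N
  have hd : Module.finrank ℝ (Fin N → ℂ) = 2 * N := by
    simp [Module.finrank_pi_fintype, Complex.finrank_real_complex, mul_comm]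
  have hcov : IsCoveringMap (coverMap hN) := by
    let := deckAction hN
    exact (isAddQuotientCoveringMap_coverMap hN).isCoveringMap
  have hcontr := contractibleSpace_discPolys N
  have := hS.homeomorph.symm.contractibleSpace
  exact
    { submanifold_total := hS.isAnalyticSubmanifold hd
      submanifold_base := hT.isAnalyticSubmanifold hd
      simplyConnected := inferInstance
      exists_covering := ⟨hT.homeomorph ∘ coverMap hN ∘ hS.homeomorph.symm,
        { isCoveringMap := (hcov.comp_homeomorph hS.homeomorph.symm).homeomorph_comp hT.homeomorph
          surjective := hT.homeomorph.surjective.comp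
            ((surjective_coverMap hN).comp hS.homeomorph.symm.surjective)
          isAnalyticLocalDiffeo := hS.isAnalyticLocalDiffeo hT hcov.isLocalHomeomorph
            (fun _ => rfl) (fun _ hc => analyticAt_coverCoeff hN hc) fun c =>
              ⟨fun b => ⟨_, sectionCoeff_mem hN _ b.2⟩, _, fun _ => rfl,
                analyticAt_sectionCoeff hN c.2, Subtype.ext (sectionCoeff_coverCoeff hN c.2),
                fun b => Subtype.ext (coverCoeff_sectionCoeff hN _ b.2)⟩ }⟩ }

lemma nonempty_fundamentalGroup_mulEquiv {N : ℕ} (hN : 0 < N) (v : gapManifold N) :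
    Nonempty (FundamentalGroup (gapManifold N) v ≃* Multiplicative ℤ) := by
  let := deckAction hN
  have hq := (isAddQuotientCoveringMap_coverMap hN).homeomorph_comp
    (isAnalyticParametrization_gapManifold N).homeomorph
  have := contractibleSpace_discPolys N
  obtain ⟨c, hc⟩ := hq.surjective v
  exact ⟨(hq.fundamentalGroupEquiv ⟨c, hc⟩).trans
    (MulOpposite.opMulEquiv (M := Multiplicative ℤ)).symm⟩

end BenjaminOno

theorem mainTheorem12 (N : ℕ) (hN : 0 < N) :
    BenjaminOno.IsUniversalCoveringManifold (2 * N)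
      (BenjaminOno.solitonManifold N) (BenjaminOno.gapManifold N) ∧
    ∀ v : BenjaminOno.gapManifold N,
      Nonempty (FundamentalGroup (BenjaminOno.gapManifold N) v ≃* Multiplicative ℤ) :=
  ⟨BenjaminOno.isUniversalCoveringManifold hN,
    BenjaminOno.nonempty_fundamentalGroup_mulEquiv hN⟩
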